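/- Let $\Gamma$ be a discrete group and let $Y\subset\Gamma$ be a finite set with $|Y|=q+1$ elements, $q\ge 2$, such that $Y^{-1}Y=\{s^{-1}t : s,t\in Y\}$ generates $\Gamma$. On the group ring $\mathbb C\Gamma$ let $\left(\sum_x c_x x\right)^*=\sum_x\overline{c_x}\,x^{-1}$, let $\tau\left(\sum_x c_x x\right)=c_e$, and let $\|a\|_2=\tau(a^*a)^{1/2}$. For $n\ge 1$ put $$E_n=\{(s_1,\dots,s_n)\in Y^n : s_i\ne s_{i+1}\ (1\le i\le n-1)\},\qquad \tilde E_{2n}=\{(s_1,\dots,s_{2n})\in E_{2n} : s_{2n}\ne s_1\},$$ $$h_n=\sum_{(s_1,\dots,s_n)\in E_n}s_1^{-1}s_2\cdots s_{n-1}^{-1}s_n\ \ (n\text{ even}),\qquad h_n=\sum_{(s_1,\dots,s_n)\in E_n}s_1s_2^{-1}s_3\cdots s_{n-1}^{-1}s_n\ \ (n\text{ odd}),$$ $$z_n=\sum_{(s_1,\dots,s_{2n})\in\tilde E_{2n}}s_1^{-1}s_2\cdots s_{2n-1}^{-1}s_{2n},\qquad h=\sum_{s\in Y}s,$$ $$\xi_n=\|h_n\|_2^2-(q+1)q^{n-1},\qquad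 \eta_n=\tau(h_{2n}),\qquad \zeta_n=\tau(z_n),\qquad m_n=\tau\big((h^*h)^n\big).$$ (The numbers $\xi_n,\eta_n,\zeta_n,m_n$ are nonnegative integers.) Then the following are equivalent, where each limit statement means that the limit exists and has the stated value: (i) $\Gamma$ is amenable, i.e. there is a left-invariant mean on $\ell^\infty(\Gamma)$; (ii) $\lim_{n\to\infty}\|h_n\|_2^{1/n}=q$; (iii) $\lim_{n\to\infty}\xi_n^{1/(2n)}=q$; (iv) $\lim_{n\to\infty}\eta_n^{1/(2n)}=q$; (v) $\lim_{n\to\infty}\zeta_n^{1/(2n)}=q$. Moreover, $\Gamma$ is amenable if and only if $\lim_{n\to\infty}m_n^{1/(2n)}=q+1$. -/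

import Mathlib

open Filter Topology
open scoped Pointwise ENNReal

noncomputable section

namespace GroupCogrowth

variable {Γ : Type*} [Group Γ]

/-! ### Amenability of a discrete group -/

/-- The left translate `x ↦ f (g⁻¹ x)` of a bounded function `f ∈ ℓ^∞(Γ)`. -/
def leftTranslate (g : Γ) (f : lp (fun _ : Γ => ℝ) ∞) : lp (fun _ : Γ => ℝ) ∞ :=
  ⟨fun x => f (g⁻¹ * x), memℓp_infty ⟨‖f‖, by
    rintro _ ⟨x, rfl⟩
    exact lp.norm_apply_le_norm ENNReal.top_ne_zero f (g⁻¹ * x)⟩⟩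

/-- A discrete group `Γ` is amenable if `ℓ^∞(Γ)` carries a left invariant mean, that is, a
positive, unital linear functional which is invariant under left translations. -/
def Amenable (Γ : Type*) [Group Γ] : Prop :=
  ∃ m : lp (fun _ : Γ => ℝ) ∞ →ₗ[ℝ] ℝ,
    (∀ f : lp (fun _ : Γ => ℝ) ∞, (∀ x, 0 ≤ f x) → 0 ≤ m f) ∧
    m 1 = 1 ∧
    ∀ (g : Γ) (f : lp (fun _ : Γ => ℝ) ∞), m (leftTranslate g f) = m f

/-! ### The group ring `ℂΓ`, its involution, trace and 2-norm -/

/-- The involution `(∑ c_x x)^* = ∑ conj(c_x) x⁻¹` of the group ring. -/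
def adjoint (a : MonoidAlgebra ℂ Γ) : MonoidAlgebra ℂ Γ :=
  a.coeff.sum fun x c => MonoidAlgebra.single x⁻¹ (starRingEnd ℂ c)

/-- The canonical trace `τ(∑ c_x x) = c_e` on the group ring. -/
def trace (a : MonoidAlgebra ℂ Γ) : ℂ := a.coeff 1

/-- The 2-norm `‖a‖₂ = τ(a^* a)^{1/2}`; here `τ(a^* a) = ∑ |c_x|²` is real and nonnegative. -/
def norm2 (a : MonoidAlgebra ℂ Γ) : ℝ := Real.sqrt (trace (adjoint a * a)).re

/-! ### Reduced and cyclically reduced words -/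

open Classical in
/-- `E_n`: tuples `(s_1, …, s_n)` in `Y^n` with `s_1 ≠ s_2 ≠ ⋯ ≠ s_n` (consecutive entries
are distinct). The entry `s_{i+1}` is `s i`. -/
def reducedWords (Y : Finset Γ) (n : ℕ) : Finset (Fin n → Γ) :=
  (Fintype.piFinset fun _ : Fin n => Y).filter fun s =>
    ∀ i j : Fin n, (j : ℕ) = i + 1 → s i ≠ s j

open Classical in
/-- `Ẽ_n`: the tuples `(s_1, …, s_n)` in `E_n` with moreover `s_n ≠ s_1`. -/
def cyclicWords (Y : Finset Γ) (n : ℕ) : Finset (Fin n → Γ) :=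
  (reducedWords Y n).filter fun s =>
    ∀ i j : Fin n, (i : ℕ) = 0 → (j : ℕ) + 1 = n → s j ≠ s i

/-- The alternating product of `(s_1, …, s_n)` that ends in `s_n`: it is
`s_1⁻¹ s_2 ⋯ s_{n-1}⁻¹ s_n` for `n` even and `s_1 s_2⁻¹ s_3 ⋯ s_{n-1}⁻¹ s_n` for `n` odd. -/
def altProd {n : ℕ} (s : Fin n → Γ) : Γ :=
  (List.ofFn fun i : Fin n => if Even (n + i + 1) then s i else (s i)⁻¹).prod

/-! ### The elements `h`, `h_n`, `z_n` of the group ring and the numerical sequences -/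

/-- `h = ∑_{s ∈ Y} s`. -/
def h (Y : Finset Γ) : MonoidAlgebra ℂ Γ := ∑ s ∈ Y, MonoidAlgebra.single s 1

/-- `h_n`, the sum of the alternating products over `E_n`. -/
def hSeq (Y : Finset Γ) (n : ℕ) : MonoidAlgebra ℂ Γ :=
  ∑ s ∈ reducedWords Y n, MonoidAlgebra.single (altProd s) 1

/-- `z_n`, the sum of the alternating products over `Ẽ_{2n}`. -/
def zSeq (Y : Finset Γ) (n : ℕ) : MonoidAlgebra ℂ Γ :=
  ∑ s ∈ cyclicWords Y (2 * n), MonoidAlgebra.single (altProd s) 1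

/-- `ξ_n = ‖h_n‖₂² - (q+1) q^{n-1}` for `n ≥ 1`, where `|Y| = q + 1`. -/
def xi (Y : Finset Γ) (q n : ℕ) : ℝ := norm2 (hSeq Y n) ^ 2 - ((q : ℝ) + 1) * (q : ℝ) ^ (n - 1)

/-- `η_n = τ(h_{2n})`, a nonnegative integer. -/
def eta (Y : Finset Γ) (n : ℕ) : ℝ := (trace (hSeq Y (2 * n))).re

/-- `ζ_n = τ(z_n)`, a nonnegative integer. -/
def zeta (Y : Finset Γ) (n : ℕ) : ℝ := (trace (zSeq Y n)).re

/-- The moments `m_n = τ((h^* h)^n)`, which are nonnegative integers. -/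
def moment (Y : Finset Γ) (n : ℕ) : ℝ := (trace ((adjoint (h Y) * h Y) ^ n)).re

end GroupCogrowth

end

/-! Up to the constant `q - 1`, the numbers `ζ_n` are the traces of the Dickson polynomials `D_n` of
the first kind with parameter `q²`, evaluated at `h^* h - 2q`; so they are integrals of polynomials
against the spectral distribution of `h^* h` on `[0, (q + 1)²]`. The substitution `t - 2q = u +
q²/u` turns `D_n` into `uⁿ + (q²/u)ⁿ` and sends `t = (q + 1)²` to `u = q²`. Hence `ζ_n` has growth
rate `q²` if and only if the spectrum of `h^* h` reaches `(q + 1)²`, that is, `‖λ(h)‖ = |Y|` in the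
left regular representation `λ`.

This last condition is Kesten's criterion for amenability. If `Γ` is amenable, a Hahn–Banach
separation gives almost invariant densities, whose square roots show that the spectral distribution
charges every neighbourhood of `|Y|²`. Conversely, unit vectors almost attaining `‖λ(h)‖ = |Y|` are
almost invariant, and averaging bounded functions against them along an ultrafilter gives an
invariant mean.

The other sequences lie between: `ζ_n ≤ η_n ≤ ξ_n ≤ ‖h_n‖₂²`, and linear recursions transfer any
growth rate of `ζ` larger than `q` to `‖h_n‖₂²`. -/

open Asymptotics

noncomputable section

namespace GroupCogrowth

/-! ### Growth rates of real sequences -/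

section GrowthRate

lemma lt_rpow_one_div_two_mul_iff {a x : ℝ} {n : ℕ} (ha : 0 ≤ a) (hx : 0 ≤ x) (hn : n ≠ 0) :
    a < x ^ (1 / (2 * (n : ℝ))) ↔ (a ^ 2) ^ n < x := by
  rw [one_div, Real.lt_rpow_inv_iff_of_pos ha hx (by positivity), Real.rpow_mul ha,
    Real.rpow_ofNat, Real.rpow_natCast]

lemma rpow_one_div_two_mul_lt_iff {a x : ℝ} {n : ℕ} (ha : 0 ≤ a) (hx : 0 ≤ x) (hn : n ≠ 0) :
    x ^ (1 / (2 * (n : ℝ))) < a ↔ x < (a ^ 2) ^ n := by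
  rw [one_div, Real.rpow_inv_lt_iff_of_pos hx ha (by positivity), Real.rpow_mul ha,
    Real.rpow_ofNat, Real.rpow_natCast]

lemma isBigO_of_eventually_le {x y : ℕ → ℝ} (hx : ∀ᶠ n in atTop, 0 ≤ x n) (hxy : x ≤ᶠ[atTop] y) :
    x =O[atTop] y :=
  .of_bound' <| by
    filter_upwards [hx, hxy] with n hx hxy
    exact (Real.norm_of_nonneg hx).trans_le (hxy.trans (le_abs_self _))

lemma eventually_lt_of_isLittleO {x y : ℕ → ℝ} (hx : ∀ᶠ n in atTop, 0 < x n)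
    (hy : ∀ᶠ n in atTop, 0 ≤ y n) (hxy : x =o[atTop] y) : ∀ᶠ n in atTop, x n < y n := by
  filter_upwards [hx, hy, hxy.bound one_half_pos] with n hx hy hxy
  rw [Real.norm_of_nonneg hx.le, Real.norm_of_nonneg hy] at hxy
  linarith

lemma not_tendsto_rpow_one_div_two_mul {x : ℕ → ℝ} {b B : ℝ} (hb : 0 ≤ b) (hB : 0 < B)
    (hbB : b < B ^ 2) (hx : ∀ᶠ n in atTop, 0 ≤ x n) (hupp : x =O[atTop] (b ^ · : ℕ → ℝ)) :
    ¬ Tendsto (fun n : ℕ => x n ^ (1 / (2 * (n : ℝ)))) atTop (𝓝 B) := by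
  intro hlim
  obtain ⟨d, hbd, hdB⟩ := exists_between hbB
  have hd : 0 < d := hb.trans_lt hbd
  have hxd : x =o[atTop] (d ^ · : ℕ → ℝ) :=
    hupp.trans_isLittleO (isLittleO_pow_pow_of_lt_left hb hbd)
  obtain ⟨n, hlt, hxn, hxd, hn⟩ := ((hlim.eventually_const_lt ((Real.sqrt_lt' hB).2 hdB)).and
    (hx.and ((hxd.bound one_pos).and (eventually_ne_atTop 0)))).exists
  rw [lt_rpow_one_div_two_mul_iff (Real.sqrt_nonneg d) hxn hn, Real.sq_sqrt hd.le] at hlt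
  rw [one_mul, Real.norm_of_nonneg hxn, Real.norm_of_nonneg (by positivity)] at hxd
  exact hxd.not_gt hlt

lemma tendsto_rpow_one_div_two_mul {x : ℕ → ℝ} {b₀ B : ℝ} (hB : 0 < B) (hb₀ : b₀ < B ^ 2)
    (hx : ∀ᶠ n in atTop, 0 ≤ x n) (hlow : ∀ b ∈ Set.Ioo b₀ (B ^ 2), (b ^ · : ℕ → ℝ) =O[atTop] x)
    (hupp : x =O[atTop] ((B ^ 2) ^ · : ℕ → ℝ)) :
    Tendsto (fun n : ℕ => x n ^ (1 / (2 * (n : ℝ)))) atTop (𝓝 B) := by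
  refine tendsto_order.2 ⟨fun a ha => ?_, fun a ha => ?_⟩
  · obtain ⟨a', ha', ha'B⟩ := exists_between (max_lt hB ha)
    have ha'0 : 0 < a' := (le_max_left _ _).trans_lt ha'
    obtain ⟨b, hb, hbB⟩ :=
      exists_between (max_lt hb₀ (pow_lt_pow_left₀ ha'B ha'0.le two_ne_zero))
    have hlow' := (isLittleO_pow_pow_of_lt_left (by positivity)
      ((le_max_right _ _).trans_lt hb)).trans_isBigO (hlow b ⟨(le_max_left _ _).trans_lt hb, hbB⟩)
    filter_upwards [hx, eventually_ne_atTop 0,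
      eventually_lt_of_isLittleO (.of_forall fun n => by positivity) hx hlow'] with n hxn hn hlt
    exact ((le_max_right _ _).trans_lt ha').trans
      ((lt_rpow_one_div_two_mul_iff ha'0.le hxn hn).2 hlt)
  · have hsq : B ^ 2 < a ^ 2 := pow_lt_pow_left₀ ha hB.le two_ne_zero
    have ha0 : 0 < a := hB.trans ha
    have hupp' := hupp.trans_isLittleO (isLittleO_pow_pow_of_lt_left (by positivity) hsq)
    filter_upwards [hx, eventually_ne_atTop 0, hupp'.bound one_half_pos] with n hxn hn hle
    rw [rpow_one_div_two_mul_lt_iff ha0.le hxn hn]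
    rw [Real.norm_of_nonneg hxn, Real.norm_of_nonneg (by positivity)] at hle
    have : 0 < (a ^ 2) ^ n := by positivity
    linarith

lemma isBigO_pow_of_linear_rec {y w : ℕ → ℝ} {r b : ℝ} (hr : 0 ≤ r) (hrb : r < b)
    (hw : w =O[atTop] (b ^ · : ℕ → ℝ)) (hrec : ∀ᶠ n in atTop, y (n + 1) = w n + r * y n) :
    y =O[atTop] (b ^ · : ℕ → ℝ) := by
  have hb : 0 < b := hr.trans_lt hrb
  obtain ⟨C, hC⟩ := hw.bound
  obtain ⟨N, hN⟩ := eventually_atTop.1 (hC.and hrec)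
  refine .of_bound (max (C / (b - r)) (|y N| / b ^ N)) (eventually_atTop.2 ⟨N, fun n hn => ?_⟩)
  rw [Real.norm_of_nonneg (by positivity : 0 ≤ b ^ n), Real.norm_eq_abs]
  set D := max (C / (b - r)) (|y N| / b ^ N)
  induction n, hn using Nat.le_induction with
  | base => exact (div_le_iff₀ (by positivity)).1 (le_max_right _ _)
  | succ n hn ih =>
    obtain ⟨hwn, hyn⟩ := hN n hn
    rw [Real.norm_of_nonneg (by positivity : 0 ≤ b ^ n), Real.norm_eq_abs] at hwn
    have hCD : C ≤ D * (b - r) := (div_le_iff₀ (sub_pos.2 hrb)).1 (le_max_left _ _)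
    calc |y (n + 1)| ≤ |w n| + r * |y n| := by
          rw [hyn, ← abs_of_nonneg hr, ← abs_mul, abs_of_nonneg hr]; exact abs_add_le _ _
      _ ≤ D * (b - r) * b ^ n + r * (D * b ^ n) := by gcongr; exact hwn.trans (by gcongr)
      _ = D * b ^ (n + 1) := by ring

lemma isBigO_comp_add_one {x : ℕ → ℝ} {b : ℝ} (hx : x =O[atTop] (b ^ · : ℕ → ℝ)) :
    (fun n => x (n + 1)) =O[atTop] (b ^ · : ℕ → ℝ) := by
  refine (hx.comp_tendsto (tendsto_add_atTop_nat 1)).trans ?_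
  simpa only [Function.comp_def, pow_succ'] using isBigO_const_mul_self b (b ^ · : ℕ → ℝ) atTop

end GrowthRate

/-! ### Bounds for Dickson polynomials of the first kind -/

section Dickson

open Polynomial

lemma aeval_dickson_add_two {R A : Type*} [CommRing R] [Ring A] [Algebra R A] (a : R) (b : A)
    (k n : ℕ) : aeval b (dickson k a (n + 2)) =
      b * aeval b (dickson k a (n + 1)) - a • aeval b (dickson k a n) := by
  rw [dickson_add_two, map_sub, map_mul, map_mul, aeval_X, aeval_C, ← Algebra.smul_def]

lemma eval_dickson_one_add {R : Type*} [CommRing R] {a u v : R} (huv : u * v = a) (n : ℕ) :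
    (dickson 1 a n).eval (u + v) = u ^ n + v ^ n := by
  induction n using Nat.twoStepInduction with
  | zero => norm_num [dickson_zero]
  | one => simp
  | more n ih₁ ih₂ =>
    simp only [dickson_add_two, eval_sub, eval_mul, eval_X, eval_C, ih₁, ih₂]
    rw [← huv]
    ring

lemma eval_dickson_one_two_mul_cos (q θ : ℝ) (n : ℕ) :
    (dickson 1 (q ^ 2) n).eval (2 * q * Real.cos θ) = 2 * q ^ n * Real.cos (n * θ) := by
  induction n using Nat.twoStepInduction with
  | zero => norm_num [dickson_zero]
  | one => simp
  | more n ih₁ ih₂ =>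
    have h₂ : ((n + 2 : ℕ) : ℝ) * θ = (n + 1 : ℕ) * θ + θ := by push_cast; ring
    have h₀ : (n : ℝ) * θ = (n + 1 : ℕ) * θ - θ := by push_cast; ring
    simp only [dickson_add_two, eval_sub, eval_mul, eval_X, eval_C, ih₁, ih₂]
    rw [h₂, h₀, Real.cos_add, Real.cos_sub]
    ring

variable {q : ℝ}

lemma abs_eval_dickson_one_le (hq : 0 < q) {t : ℝ} (ht : |t| ≤ 2 * q) (n : ℕ) :
    |(dickson 1 (q ^ 2) n).eval t| ≤ 2 * q ^ n := by
  obtain ⟨ht₁, ht₂⟩ := abs_le.1 ht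
  have hcos : t = 2 * q * Real.cos (Real.arccos (t / (2 * q))) := by
    rw [Real.cos_arccos, mul_div_cancel₀ _ (by positivity)]
    · rw [le_div_iff₀ (by positivity)]; linarith
    · rw [div_le_iff₀ (by positivity)]; linarith
  rw [hcos, eval_dickson_one_two_mul_cos, abs_mul, abs_of_nonneg (by positivity)]
  exact mul_le_of_le_one_right (by positivity) (Real.abs_cos_le_one _)

lemma strictMonoOn_add_sq_div (hq : 0 < q) : StrictMonoOn (fun u => u + q ^ 2 / u) (Set.Ici q) := by
  intro u hu v hv huv
  have hu₀ : 0 < u := hq.trans_le hu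
  have hv₀ : 0 < v := hq.trans_le hv
  have hsub : v + q ^ 2 / v - (u + q ^ 2 / u) = (v - u) * (u * v - q ^ 2) / (u * v) := by
    field_simp; ring
  have hprod : q ^ 2 < u * v := by nlinarith [Set.mem_Ici.1 hu]
  have : 0 < (v - u) * (u * v - q ^ 2) / (u * v) :=
    div_pos (mul_pos (sub_pos.2 huv) (sub_pos.2 hprod)) (by positivity)
  exact sub_pos.1 (hsub ▸ this)

lemma exists_add_sq_div_eq (hq : 0 < q) {t : ℝ} (ht : 2 * q ≤ t) :
    ∃ u ∈ Set.Ici q, u + q ^ 2 / u = t := by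
  have hdisc : √(t ^ 2 - 4 * q ^ 2) ^ 2 = t ^ 2 - 4 * q ^ 2 := Real.sq_sqrt (by nlinarith)
  have hsqrt := Real.sqrt_nonneg (t ^ 2 - 4 * q ^ 2)
  have hu : 0 < (t + √(t ^ 2 - 4 * q ^ 2)) / 2 := by linarith
  refine ⟨(t + √(t ^ 2 - 4 * q ^ 2)) / 2, by rw [Set.mem_Ici]; linarith, ?_⟩
  rw [← eq_sub_iff_add_eq', div_eq_iff hu.ne']
  linarith

lemma eval_dickson_one_cases (hq : 0 < q) {t : ℝ} (ht : -(2 * q) ≤ t) :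
    (t ≤ 2 * q ∧ ∀ n, |(dickson 1 (q ^ 2) n).eval t| ≤ 2 * q ^ n) ∨
      ∃ u ∈ Set.Ici q, t = u + q ^ 2 / u ∧
        ∀ n, (dickson 1 (q ^ 2) n).eval t = u ^ n + (q ^ 2 / u) ^ n := by
  rcases le_total t (2 * q) with h | h
  · exact .inl ⟨h, abs_eval_dickson_one_le hq (abs_le.2 ⟨ht, h⟩)⟩
  · obtain ⟨u, hu, rfl⟩ := exists_add_sq_div_eq hq h
    exact .inr ⟨u, hu, rfl, eval_dickson_one_add (mul_div_cancel₀ _ (hq.trans_le hu).ne')⟩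

lemma neg_le_eval_dickson_one (hq : 0 < q) {t : ℝ} (ht : -(2 * q) ≤ t) (n : ℕ) :
    -(2 * q ^ n) ≤ (dickson 1 (q ^ 2) n).eval t := by
  rcases eval_dickson_one_cases hq ht with ⟨-, h⟩ | ⟨u, hu, -, h⟩
  · exact (abs_le.1 (h n)).1
  · have hu₀ : 0 < u := hq.trans_le hu
    rw [h n]
    exact (neg_nonpos.2 (by positivity)).trans (by positivity)

lemma eval_dickson_one_le (hq : 0 < q) {b t : ℝ} (hb : b ∈ Set.Ici q) (ht : -(2 * q) ≤ t)
    (htb : t ≤ b + q ^ 2 / b) (n : ℕ) : (dickson 1 (q ^ 2) n).eval t ≤ 2 * b ^ n := by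
  rcases eval_dickson_one_cases hq ht with ⟨-, h⟩ | ⟨u, hu, rfl, h⟩
  · refine (abs_le.1 (h n)).2.trans ?_
    gcongr
    exact hb
  · have hub : u ≤ b := ((strictMonoOn_add_sq_div hq).le_iff_le hu hb).1 htb
    have hu₀ : 0 < u := hq.trans_le hu
    have hv : q ^ 2 / u ≤ b := by
      rw [div_le_iff₀ hu₀]
      nlinarith [Set.mem_Ici.1 hu]
    rw [h n, two_mul]
    gcongr

lemma pow_le_eval_dickson_one (hq : 0 < q) {b t : ℝ} (hb : b ∈ Set.Ioi q)
    (htb : b + q ^ 2 / b ≤ t) (n : ℕ) : b ^ n ≤ (dickson 1 (q ^ 2) n).eval t := by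
  have hmono := strictMonoOn_add_sq_div hq
  have h2q : 2 * q < b + q ^ 2 / b := by
    calc 2 * q = q + q ^ 2 / q := by field_simp; ring
      _ < b + q ^ 2 / b := hmono Set.self_mem_Ici (Set.mem_Ici_of_Ioi hb) hb
  rcases eval_dickson_one_cases hq (t := t) (by linarith) with ⟨htq, -⟩ | ⟨u, hu, rfl, h⟩
  · linarith
  · have hbu : b ≤ u := (hmono.le_iff_le (Set.mem_Ici_of_Ioi hb) hu).1 htb
    have hu₀ : 0 < u := hq.trans_le hu
    have hb₀ : 0 < b := hq.trans hb
    rw [h n]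
    exact (pow_le_pow_left₀ hb₀.le hbu n).trans (le_add_of_nonneg_right (by positivity))

end Dickson

/-! ### Reduced and cyclically reduced words -/

section Words

variable {Γ : Type*} {Y : Finset Γ} {n : ℕ}

lemma mem_reducedWords {s : Fin (n + 1) → Γ} :
    s ∈ reducedWords Y (n + 1) ↔ (∀ i, s i ∈ Y) ∧ ∀ i : Fin n, s i.castSucc ≠ s i.succ := by
  simp only [reducedWords, Finset.mem_filter, Fintype.mem_piFinset, and_congr_right_iff]
  refine fun _ => ⟨fun h i => h _ _ (by simp), fun h i j hij => ?_⟩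
  obtain ⟨j, rfl⟩ := Fin.exists_succ_eq.2 (show j ≠ 0 by rintro rfl; simp at hij)
  obtain rfl : i = j.castSucc := Fin.ext (by simpa using hij.symm)
  exact h j

lemma mem_cyclicWords {s : Fin (n + 1) → Γ} :
    s ∈ cyclicWords Y (n + 1) ↔ s ∈ reducedWords Y (n + 1) ∧ s (Fin.last n) ≠ s 0 := by
  simp only [cyclicWords, Finset.mem_filter, and_congr_right_iff]
  refine fun _ => ⟨fun h => h 0 (Fin.last n) (by simp) (by simp), fun h i j hi hj => ?_⟩
  obtain rfl : i = 0 := Fin.ext hi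
  obtain rfl : j = Fin.last n := Fin.ext (by simpa using hj)
  exact h

open Classical in
lemma cyclicWords_eq_filter (Y : Finset Γ) (n : ℕ) :
    cyclicWords Y (n + 1) = {s ∈ reducedWords Y (n + 1) | s (Fin.last n) ≠ s 0} := by
  ext s
  rw [mem_cyclicWords, Finset.mem_filter]

lemma mem_cyclicWords_iff_forall {s : Fin (n + 1) → Γ} :
    s ∈ cyclicWords Y (n + 1) ↔ (∀ i, s i ∈ Y) ∧ ∀ i, s i ≠ s (i + 1) := by
  rw [mem_cyclicWords, mem_reducedWords, and_assoc, Fin.forall_fin_succ' (P := fun i => s i ≠ _)]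
  simp

lemma cons_mem_reducedWords {a : Γ} {w : Fin (n + 1) → Γ} :
    (Fin.cons a w : Fin (n + 2) → Γ) ∈ reducedWords Y (n + 2) ↔
      w ∈ reducedWords Y (n + 1) ∧ a ≠ w 0 ∧ a ∈ Y := by
  simp only [mem_reducedWords, Fin.forall_fin_succ (n := n + 1), Fin.forall_fin_succ (n := n),
    Fin.castSucc_zero, Fin.castSucc_succ, Fin.cons_zero, Fin.cons_succ]
  tauto

lemma snoc_mem_reducedWords {a : Γ} {w : Fin (n + 1) → Γ} :
    (Fin.snoc w a : Fin (n + 2) → Γ) ∈ reducedWords Y (n + 2) ↔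
      w ∈ reducedWords Y (n + 1) ∧ a ≠ w (Fin.last n) ∧ a ∈ Y := by
  simp only [mem_reducedWords, Fin.forall_fin_succ' (n := n + 1), Fin.forall_fin_succ' (n := n),
    Fin.succ_last, Fin.succ_castSucc, Fin.snoc_castSucc, Fin.snoc_last, ne_comm (a := a)]
  tauto

variable {M : Type*} [AddCommMonoid M]

lemma sum_reducedWords_one (f : (Fin 1 → Γ) → M) :
    ∑ s ∈ reducedWords Y 1, f s = ∑ a ∈ Y, f fun _ => a := by
  refine Finset.sum_equiv (Equiv.funUnique (Fin 1) Γ) (fun s => ?_) fun s _ => ?_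
  · simp [mem_reducedWords]
  · exact congrArg f (funext fun i => congrArg s (Subsingleton.elim _ _))

open Classical in
lemma sum_reducedWords_cons (f : (Fin (n + 2) → Γ) → M) :
    ∑ s ∈ reducedWords Y (n + 2), f s =
      ∑ w ∈ reducedWords Y (n + 1), ∑ a ∈ Y.erase (w 0), f (Fin.cons a w) := by
  rw [Finset.sum_sigma']
  refine Finset.sum_bij' (fun s _ => ⟨Fin.tail s, s 0⟩) (fun p _ => Fin.cons p.2 p.1)
    (fun s hs => ?_) (fun p hp => ?_) (by simp) (by simp) (by simp)
  · rw [← Fin.cons_self_tail s, cons_mem_reducedWords] at hs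
    simpa only [Finset.mem_sigma, Finset.mem_erase] using hs
  · simpa only [cons_mem_reducedWords, Finset.mem_sigma, Finset.mem_erase] using hp

open Classical in
lemma sum_reducedWords_snoc (f : (Fin (n + 2) → Γ) → M) :
    ∑ s ∈ reducedWords Y (n + 2), f s =
      ∑ w ∈ reducedWords Y (n + 1), ∑ a ∈ Y.erase (w (Fin.last n)), f (Fin.snoc w a) := by
  rw [Finset.sum_sigma']
  refine Finset.sum_bij' (fun s _ => ⟨Fin.init s, s (Fin.last _)⟩) (fun p _ => Fin.snoc p.1 p.2)
    (fun s hs => ?_) (fun p hp => ?_) (by simp) (by simp) (by simp)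
  · rw [← Fin.snoc_init_self s, snoc_mem_reducedWords] at hs
    simpa only [Finset.mem_sigma, Finset.mem_erase] using hs
  · simpa only [snoc_mem_reducedWords, Finset.mem_sigma, Finset.mem_erase] using hp

open Classical in
lemma sum_reducedWords_last_eq_head (f : (Fin (n + 3) → Γ) → M) :
    ∑ s ∈ reducedWords Y (n + 3) with s (Fin.last _) = s 0, f s =
      ∑ v ∈ reducedWords Y (n + 1), ∑ a ∈ Y.erase (v (Fin.last n)) ∩ Y.erase (v 0),
        f (Fin.cons a (Fin.snoc v a : Fin (n + 2) → Γ)) := by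
  rw [Finset.sum_filter, sum_reducedWords_cons, sum_reducedWords_snoc]
  refine Finset.sum_congr rfl fun v _ => ?_
  rw [← Finset.filter_mem_eq_inter, Finset.sum_filter]
  refine Finset.sum_congr rfl fun a _ => ?_
  have h0 : (Fin.snoc v a : Fin (n + 2) → Γ) 0 = v 0 :=
    Fin.snoc_castSucc (i := (0 : Fin (n + 1))) ..
  have hlast (b : Γ) :
      (Fin.cons b (Fin.snoc v a : Fin (n + 2) → Γ) : Fin (n + 3) → Γ) (Fin.last _) = a := by
    rw [← Fin.succ_last, Fin.cons_succ, Fin.snoc_last]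
  simp only [h0, hlast, Fin.cons_zero, Finset.sum_ite_eq]

variable {q : ℕ}

lemma card_reducedWords (hY : Y.card = q + 1) (n : ℕ) :
    (reducedWords Y (n + 1)).card = (q + 1) * q ^ n := by
  classical
  induction n with
  | zero => rw [Finset.card_eq_sum_ones, sum_reducedWords_one, ← Finset.card_eq_sum_ones, hY]; simp
  | succ n ih =>
    have hlast : ∀ w ∈ reducedWords Y (n + 1), ∑ a ∈ Y.erase (w 0), 1 = q := fun w hw => by
      rw [← Finset.card_eq_sum_ones, Finset.card_erase_of_mem ((mem_reducedWords.1 hw).1 0), hY,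
        Nat.add_sub_cancel]
    rw [Finset.card_eq_sum_ones, sum_reducedWords_cons, Finset.sum_congr rfl hlast,
      Finset.sum_const, ih, smul_eq_mul, pow_succ, mul_assoc]

open Classical in
lemma card_erase_inter_erase (hY : Y.card = q + 1) {a b : Γ} (ha : a ∈ Y) (hb : b ∈ Y) :
    ((Y.erase a ∩ Y.erase b).card : ℝ) = q - if a ≠ b then 1 else 0 := by
  rw [Finset.inter_erase, Finset.erase_inter, Finset.inter_self]
  split_ifs with hab
  · have hcard := Finset.card_erase_add_one (Finset.mem_erase.2 ⟨hab.symm, hb⟩)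
    rw [← add_left_inj 1, Finset.card_erase_add_one ha, hY] at hcard
    rw [eq_sub_iff_add_eq]
    exact_mod_cast Nat.succ_injective hcard
  · rw [not_not] at hab
    rw [← hab, Finset.erase_idem, Finset.card_erase_of_mem ha, hY, Nat.add_sub_cancel, sub_zero]

end Words

/-! ### The recursion for `h_n` -/

section GroupRing

variable {Γ : Type*} [Group Γ]

open MonoidAlgebra (single single_mul_single)

lemma adjoint_single (x : Γ) (c : ℂ) : adjoint (single x c) = single x⁻¹ (starRingEnd ℂ c) := by
  simp [adjoint, Finsupp.sum_single_index]

lemma adjoint_zero : adjoint (0 : MonoidAlgebra ℂ Γ) = 0 := by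
  simp [adjoint]

lemma adjoint_add (a b : MonoidAlgebra ℂ Γ) : adjoint (a + b) = adjoint a + adjoint b := by
  classical
  rw [adjoint, MonoidAlgebra.coeff_add]
  exact Finsupp.sum_add_index' (by simp) (by simp [MonoidAlgebra.single_add])

/-- The involution of the group ring as an additive map. -/
def adjointAddHom : MonoidAlgebra ℂ Γ →+ MonoidAlgebra ℂ Γ where
  toFun := adjoint
  map_zero' := adjoint_zero
  map_add' := adjoint_add

lemma adjoint_sum {ι : Type*} (s : Finset ι) (f : ι → MonoidAlgebra ℂ Γ) :
    adjoint (∑ i ∈ s, f i) = ∑ i ∈ s, adjoint (f i) :=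
  map_sum adjointAddHom f s

lemma adjoint_nsmul (k : ℕ) (a : MonoidAlgebra ℂ Γ) : adjoint (k • a) = k • adjoint a :=
  map_nsmul adjointAddHom k a

lemma adjoint_adjoint (a : MonoidAlgebra ℂ Γ) : adjoint (adjoint a) = a := by
  induction a using MonoidAlgebra.induction_linear with
  | zero => simp only [adjoint_zero]
  | add a b ha hb => rw [adjoint_add, adjoint_add, ha, hb]
  | single x c => simp [adjoint_single]

lemma adjoint_mul (a b : MonoidAlgebra ℂ Γ) : adjoint (a * b) = adjoint b * adjoint a := by
  induction a using MonoidAlgebra.induction_linear with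
  | zero => simp only [zero_mul, mul_zero, adjoint_zero]
  | add a₁ a₂ h₁ h₂ => rw [add_mul, adjoint_add, adjoint_add, mul_add, h₁, h₂]
  | single x c =>
    induction b using MonoidAlgebra.induction_linear with
    | zero => simp only [zero_mul, mul_zero, adjoint_zero]
    | add b₁ b₂ h₁ h₂ => rw [mul_add, adjoint_add, adjoint_add, add_mul, h₁, h₂]
    | single y d => simp [adjoint_single, single_mul_single, mul_comm]

/-- The real part of the canonical trace, as a real linear functional. -/
def reTrace : MonoidAlgebra ℂ Γ →ₗ[ℝ] ℝ where
  toFun a := (trace a).re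
  map_add' a b := by simp [trace]
  map_smul' c a := by simp [trace]

lemma reTrace_apply (a : MonoidAlgebra ℂ Γ) : reTrace a = (trace a).re := rfl

lemma reTrace_one : reTrace (1 : MonoidAlgebra ℂ Γ) = 1 := by
  simp [reTrace_apply, trace, MonoidAlgebra.one_def]

open Classical in
lemma reTrace_single (x : Γ) (c : ℂ) : reTrace (single x c) = if x = 1 then c.re else 0 := by
  rw [reTrace_apply, trace, MonoidAlgebra.coeff_single, Finsupp.single_apply]
  split_ifs <;> rfl

open Classical in
lemma reTrace_sum_single {ι : Type*} (s : Finset ι) (f : ι → Γ) :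
    reTrace (∑ i ∈ s, single (f i) (1 : ℂ)) = ∑ i ∈ s, if f i = 1 then 1 else 0 := by
  simp only [map_sum, reTrace_single, Complex.one_re]

lemma reTrace_adjoint (a : MonoidAlgebra ℂ Γ) : reTrace (adjoint a) = reTrace a := by
  classical
  induction a using MonoidAlgebra.induction_linear with
  | zero => rw [adjoint_zero]
  | add a b ha hb => rw [adjoint_add, map_add, map_add, ha, hb]
  | single x c => simp only [adjoint_single, reTrace_single, inv_eq_one, Complex.conj_re]

lemma altProd_cons {n : ℕ} (a : Γ) (w : Fin n → Γ) :
    altProd (Fin.cons a w : Fin (n + 1) → Γ) = (if Even n then a else a⁻¹) * altProd w := by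
  have hparity (i : ℕ) : Even (n + 1 + (i + 1) + 1) ↔ Even (n + i + 1) := by grind
  have hhead : Even (n + 1 + 0 + 1) ↔ Even n := by grind
  simp only [altProd, List.ofFn_succ, Fin.val_zero, Fin.val_succ, Fin.cons_zero, Fin.cons_succ,
    List.prod_cons, hparity, hhead]

lemma altProd_snoc {n : ℕ} (w : Fin n → Γ) (a : Γ) :
    altProd (Fin.snoc w a : Fin (n + 1) → Γ) = altProd w⁻¹ * a := by
  have hparity (i : ℕ) : Even (n + 1 + i + 1) ↔ ¬Even (n + i + 1) := by grind
  have hlast : ¬Even (n + n + 1) := by grind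
  simp only [altProd, List.ofFn_succ', List.concat_eq_append, List.prod_append, Fin.snoc_castSucc,
    Fin.snoc_last, Fin.val_castSucc, Fin.val_last, List.prod_singleton, hparity, hlast, ite_not,
    if_false, Pi.inv_apply, inv_inv]

variable (Y : Finset Γ)

/-- The factor `h` or `h^*` by which `h_n` is multiplied on the left to prefix its words by one
more letter; the exponent of that letter depends on the parity of `n`. -/
def stepElem (n : ℕ) : MonoidAlgebra ℂ Γ :=
  if Even n then h Y else adjoint (h Y)

lemma stepElem_of_even {n : ℕ} (hn : Even n) : stepElem Y n = h Y := if_pos hn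

lemma stepElem_of_odd {n : ℕ} (hn : Odd n) : stepElem Y n = adjoint (h Y) :=
  if_neg (Nat.not_even_iff_odd.2 hn)

lemma adjoint_stepElem (n : ℕ) : adjoint (stepElem Y n) = stepElem Y (n + 1) := by
  rcases n.even_or_odd with hn | hn
  · rw [stepElem_of_even Y hn, stepElem_of_odd Y hn.add_one]
  · rw [stepElem_of_odd Y hn, stepElem_of_even Y hn.add_one, adjoint_adjoint]

lemma stepElem_eq_sum (n : ℕ) :
    stepElem Y n = ∑ a ∈ Y, single (if Even n then a else a⁻¹) 1 := by
  rw [stepElem]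
  split_ifs
  · rfl
  · simp only [h, adjoint_sum, adjoint_single, map_one]

lemma hSeq_one : hSeq Y 1 = h Y := by
  simp [hSeq, sum_reducedWords_one, altProd, h]

lemma stepElem_mul_hSeq (n : ℕ) :
    stepElem Y (n + 1) * hSeq Y (n + 1) = hSeq Y (n + 2) +
      ∑ w ∈ reducedWords Y (n + 1), single (altProd (Fin.tail w)) 1 := by
  classical
  rw [stepElem_eq_sum, hSeq, hSeq, sum_reducedWords_cons, ← Finset.sum_add_distrib, Finset.mul_sum]
  refine Finset.sum_congr rfl fun w hw => ?_
  rw [Finset.sum_mul, ← Finset.sum_erase_add _ _ ((mem_reducedWords.1 hw).1 0)]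
  simp only [single_mul_single, mul_one, altProd_cons]
  congr 2
  conv_lhs => rw [← Fin.cons_self_tail w, altProd_cons]
  by_cases hn : Even n <;> simp [Nat.even_add_one, hn]

/-- The self-adjoint element `h^*h - 2q`: it satisfies the recursion of the Dickson polynomials with
parameter `q²` against the elements `h_{2n}`. -/
def shiftedGram (q : ℕ) : MonoidAlgebra ℂ Γ := adjoint (h Y) * h Y - (2 * q) • 1

variable {Y} {q : ℕ} (hY : Y.card = q + 1)
include hY

lemma stepElem_mul_hSeq_succ (n : ℕ) :
    stepElem Y (n + 2) * hSeq Y (n + 2) = hSeq Y (n + 3) + q • hSeq Y (n + 1) := by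
  classical
  rw [stepElem_mul_hSeq, sum_reducedWords_cons, hSeq, hSeq, Finset.smul_sum]
  congr 1
  refine Finset.sum_congr rfl fun w hw => ?_
  simp only [Fin.tail_cons, Finset.sum_const,
    Finset.card_erase_of_mem ((mem_reducedWords.1 hw).1 0), hY, Nat.add_sub_cancel]

lemma h_mul_hSeq {n : ℕ} (hn : Even n) :
    h Y * hSeq Y (n + 2) = hSeq Y (n + 3) + q • hSeq Y (n + 1) := by
  rw [← stepElem_mul_hSeq_succ hY, stepElem_of_even Y (by grind)]

lemma adjoint_h_mul_hSeq {n : ℕ} (hn : Odd n) :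
    adjoint (h Y) * hSeq Y (n + 2) = hSeq Y (n + 3) + q • hSeq Y (n + 1) := by
  rw [← stepElem_mul_hSeq_succ hY, stepElem_of_odd Y (by grind)]

lemma adjoint_h_mul_h : adjoint (h Y) * h Y = hSeq Y 2 + (q + 1) • 1 := by
  have hstep : stepElem Y 1 * hSeq Y 1 = hSeq Y 2 + _ := stepElem_mul_hSeq Y 0
  have htail (a : Γ) : single (altProd (Fin.tail fun _ : Fin 1 => a)) (1 : ℂ) = 1 := rfl
  rw [sum_reducedWords_one] at hstep
  simpa only [stepElem_of_odd Y odd_one, hSeq_one, htail, Finset.sum_const, hY] using hstep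

lemma shiftedGram_eq : shiftedGram Y q = hSeq Y 2 - ((q : ℝ) - 1) • 1 := by
  rw [shiftedGram, adjoint_h_mul_h hY]
  module

lemma shiftedGram_mul_hSeq_two :
    shiftedGram Y q * hSeq Y 2 = hSeq Y 4 + (q * (q + 1)) • 1 := by
  have hhead : h Y * hSeq Y 2 = hSeq Y 3 + q • hSeq Y 1 := h_mul_hSeq hY Even.zero
  have htail : adjoint (h Y) * hSeq Y 3 = hSeq Y 4 + q • hSeq Y 2 := adjoint_h_mul_hSeq hY odd_one
  rw [shiftedGram, sub_mul, mul_assoc, hhead, mul_add, htail, mul_smul_comm, hSeq_one,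
    adjoint_h_mul_h hY, smul_mul_assoc, one_mul]
  module

lemma shiftedGram_mul_hSeq (n : ℕ) :
    shiftedGram Y q * hSeq Y (2 * n + 4) = hSeq Y (2 * n + 6) + q ^ 2 • hSeq Y (2 * n + 2) := by
  rw [shiftedGram, sub_mul, mul_assoc, h_mul_hSeq hY (by grind : Even (2 * n + 2)), mul_add,
    mul_smul_comm, adjoint_h_mul_hSeq hY (by grind : Odd (2 * n + 3)),
    adjoint_h_mul_hSeq hY (by grind : Odd (2 * n + 1)), smul_mul_assoc, one_mul]
  module

open Polynomial in
lemma hSeq_sub_eq_aeval_dickson (n : ℕ) :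
    hSeq Y (2 * n + 4) - q • hSeq Y (2 * n + 2) =
      aeval (shiftedGram Y q)
        (dickson 1 ((q : ℝ) ^ 2) (n + 2) - dickson 1 ((q : ℝ) ^ 2) (n + 1)) := by
  set B := shiftedGram Y q with hB
  have hrec (n) : hSeq Y (2 * n + 6) = B * hSeq Y (2 * n + 4) - (q ^ 2) • hSeq Y (2 * n + 2) :=
    eq_sub_of_add_eq (shiftedGram_mul_hSeq hY n).symm
  have h₂ : hSeq Y 2 = B + ((q : ℝ) - 1) • 1 := by rw [hB, shiftedGram_eq hY, sub_add_cancel]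
  have h₄ : hSeq Y 4 = B * hSeq Y 2 - (q * (q + 1)) • 1 :=
    eq_sub_of_add_eq (shiftedGram_mul_hSeq_two hY).symm
  have hD₀ : aeval B (dickson 1 ((q : ℝ) ^ 2) 0) = (2 : ℝ) • 1 := by
    have hC : (3 - (1 : ℕ) : ℝ[X]) = C 2 := by rw [map_ofNat]; norm_num
    rw [dickson_zero, hC, aeval_C, Algebra.algebraMap_eq_smul_one]
  have hD₁ : aeval B (dickson 1 ((q : ℝ) ^ 2) 1) = B := by rw [dickson_one, aeval_X]
  have hD₂ : aeval B (dickson 1 ((q : ℝ) ^ 2) 2) = B * B - (2 * (q : ℝ) ^ 2) • 1 := by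
    rw [aeval_dickson_add_two, zero_add, hD₁, hD₀]
    module
  induction n using Nat.twoStepInduction with
  | zero =>
    rw [map_sub, hD₂, hD₁, h₄, h₂, mul_add, mul_smul_comm, mul_one]
    module
  | one =>
    rw [map_sub, aeval_dickson_add_two, hD₂, hD₁, hrec 0, h₄, h₂]
    simp only [mul_add, mul_sub, mul_smul_comm, mul_one]
    module
  | more n ih₁ ih₂ =>
    have hdiff : hSeq Y (2 * (n + 2) + 4) - q • hSeq Y (2 * (n + 2) + 2) =
        B * (hSeq Y (2 * (n + 1) + 4) - q • hSeq Y (2 * (n + 1) + 2)) -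
          (q : ℝ) ^ 2 • (hSeq Y (2 * n + 4) - q • hSeq Y (2 * n + 2)) := by
      have hrec₁ : hSeq Y (2 * (n + 2) + 4) = _ := hrec (n + 1)
      have hrec₀ : hSeq Y (2 * (n + 2) + 2) = _ := hrec n
      rw [hrec₁, hrec₀, mul_sub, mul_smul_comm]
      module
    rw [hdiff, ih₁, ih₂, map_sub, map_sub, map_sub, aeval_dickson_add_two _ _ _ (n + 2),
      aeval_dickson_add_two _ _ _ (n + 1), mul_sub]
    module

lemma adjoint_hSeq_mul_hSeq_exchange {m n : ℕ} (hmn : Odd (m + n)) :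
    adjoint (hSeq Y (m + 3)) * hSeq Y (n + 2) + q • (adjoint (hSeq Y (m + 1)) * hSeq Y (n + 2)) =
      adjoint (hSeq Y (m + 2)) * hSeq Y (n + 3) +
        q • (adjoint (hSeq Y (m + 2)) * hSeq Y (n + 1)) := by
  have hstep : stepElem Y (n + 2) = adjoint (stepElem Y (m + 2)) := by
    rw [adjoint_stepElem, stepElem, stepElem]
    congr 1
    grind
  rw [← mul_smul_comm q (adjoint (hSeq Y (m + 2))), ← mul_add, ← stepElem_mul_hSeq_succ hY, hstep,
    ← mul_assoc, ← adjoint_mul, stepElem_mul_hSeq_succ hY, adjoint_add, adjoint_nsmul,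
    add_mul, smul_mul_assoc]

lemma adjoint_hSeq_mul_hSeq_two {m : ℕ} (hm : Even m) :
    adjoint (hSeq Y (m + 2)) * hSeq Y 2 + adjoint (hSeq Y (m + 2)) =
      q • (adjoint (hSeq Y (m + 1)) * hSeq Y 1) + adjoint (hSeq Y (m + 4)) := by
  have hleft : adjoint (hSeq Y (m + 2)) * adjoint (h Y) =
      adjoint (hSeq Y (m + 3)) + q • adjoint (hSeq Y (m + 1)) := by
    rw [← adjoint_mul, h_mul_hSeq hY hm, adjoint_add, adjoint_nsmul]
  have hright : adjoint (hSeq Y (m + 3)) * h Y =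
      adjoint (hSeq Y (m + 4)) + q • adjoint (hSeq Y (m + 2)) := by
    rw [← adjoint_adjoint (h Y), ← adjoint_mul, adjoint_h_mul_hSeq hY hm.add_one, adjoint_add,
      adjoint_nsmul]
  rw [← sub_eq_of_eq_add (adjoint_h_mul_h hY), hSeq_one, mul_sub, ← mul_assoc, hleft, add_mul,
    hright, mul_smul_comm, mul_one, smul_mul_assoc]
  module

lemma adjoint_hSeq_mul_hSeq_succ {m n : ℕ} (hmn : Even (m + n)) :
    adjoint (hSeq Y (m + 2)) * hSeq Y (n + 2) + adjoint (hSeq Y (m + n + 2)) =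
      q • (adjoint (hSeq Y (m + 1)) * hSeq Y (n + 1)) + adjoint (hSeq Y (m + n + 4)) := by
  induction n generalizing m with
  | zero => exact adjoint_hSeq_mul_hSeq_two hY hmn
  | succ n ih =>
    have hprev := ih (m := m + 1) (by grind)
    have hexch := adjoint_hSeq_mul_hSeq_exchange hY (m := m) (n := n) (by grind)
    rw [show m + 1 + n = m + (n + 1) by ring] at hprev
    linear_combination (norm := module) hprev - hexch

end GroupRing

/-! ### The sequences `η`, `ζ` and `‖h_n‖₂²` -/

section Counting

variable {Γ : Type*} [Group Γ] (Y : Finset Γ) (n : ℕ)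

lemma eta_eq_reTrace : eta Y n = reTrace (hSeq Y (2 * n)) := rfl

open Classical in
lemma eta_eq_sum : eta Y n = ∑ s ∈ reducedWords Y (2 * n), if altProd s = 1 then 1 else 0 :=
  reTrace_sum_single _ _

open Classical in
lemma zeta_eq_sum : zeta Y n = ∑ s ∈ cyclicWords Y (2 * n), if altProd s = 1 then 1 else 0 :=
  reTrace_sum_single _ _

lemma zeta_nonneg : 0 ≤ zeta Y n := by
  classical
  rw [zeta_eq_sum]
  exact Finset.sum_nonneg fun _ _ => by split_ifs <;> norm_num

lemma zeta_le_eta : zeta Y n ≤ eta Y n := by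
  classical
  rw [zeta_eq_sum, eta_eq_sum]
  refine Finset.sum_le_sum_of_subset_of_nonneg (Finset.filter_subset _ _) fun _ _ _ => ?_
  split_ifs <;> norm_num

lemma zeta_one : zeta Y 1 = eta Y 1 := by
  classical
  rw [zeta_eq_sum, eta_eq_sum]
  refine Finset.sum_congr (Finset.ext fun s => ?_) fun _ _ => rfl
  rw [mem_cyclicWords (n := 1), and_iff_left_iff_imp]
  exact fun hs => ((mem_reducedWords.1 hs).2 0).symm

open Classical in
/-- Rotating a cyclically reduced word by one letter and inverting its letters exchanges `Y` and
`Y⁻¹` and replaces the alternating product by a conjugate. -/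
lemma zeta_inv : zeta Y⁻¹ (n + 1) = zeta Y (n + 1) := by
  rw [zeta_eq_sum, zeta_eq_sum, show 2 * (n + 1) = (2 * n + 1) + 1 by ring]
  refine (Finset.sum_bij' (fun s _ i => (s (i + 1))⁻¹) (fun s _ i => (s (i - 1))⁻¹)
    (fun s hs => ?_) (fun s hs => ?_) (by simp) (by simp) fun s _ => ?_).symm
  · rw [mem_cyclicWords_iff_forall] at hs ⊢
    exact ⟨fun i => by simpa [Finset.mem_inv'] using hs.1 (i + 1),
      fun i => by simpa using hs.2 (i + 1)⟩
  · rw [mem_cyclicWords_iff_forall] at hs ⊢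
    exact ⟨fun i => by simpa [Finset.mem_inv'] using hs.1 (i - 1),
      fun i => by simpa using hs.2 (i - 1)⟩
  · have hrotate : (fun i => (s (i + 1))⁻¹) =
        (Fin.snoc (Fin.tail s)⁻¹ (s 0)⁻¹ : Fin (2 * n + 1 + 1) → Γ) := by
      funext i
      refine Fin.lastCases (by simp) (fun i => ?_) i
      simp [Fin.tail, Fin.coeSucc_eq_succ]
    have hprod : altProd s = (s 0)⁻¹ * altProd (Fin.tail s) := by
      conv_lhs => rw [← Fin.cons_self_tail s, altProd_cons, if_neg (by simp)]
    rw [hrotate, altProd_snoc, inv_inv, hprod]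
    exact if_congr (by rw [mul_inv_eq_one, inv_mul_eq_one, eq_comm]) rfl rfl

open Classical in
lemma sum_reducedWords_inv {M : Type*} [AddCommMonoid M] (f : (Fin (n + 1) → Γ) → M) :
    ∑ v ∈ reducedWords Y⁻¹ (n + 1), f v = ∑ v ∈ reducedWords Y (n + 1), f v⁻¹ :=
  Finset.sum_equiv (Equiv.inv _) (fun v => by simp [mem_reducedWords, Finset.mem_inv']) (by simp)

lemma altProd_cons_snoc_self {n : ℕ} (hn : Even n) (v : Fin n → Γ) (a : Γ) :
    altProd (Fin.cons a (Fin.snoc v a : Fin (n + 1) → Γ) : Fin (n + 2) → Γ) =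
      a⁻¹ * altProd v⁻¹ * a := by
  rw [altProd_cons, if_neg (Nat.not_even_iff_odd.2 hn.add_one), altProd_snoc, mul_assoc]

variable {Y} {q : ℕ} (hY : Y.card = q + 1)
include hY

open Classical in
lemma eta_sub_zeta : eta Y (n + 2) - zeta Y (n + 2) = q * eta Y⁻¹ (n + 1) - zeta Y⁻¹ (n + 1) := by
  have heven : Even (2 * n + 1 + 1) := by grind
  calc eta Y (n + 2) - zeta Y (n + 2)
      = ∑ s ∈ reducedWords Y (2 * n + 1 + 3) with s (Fin.last _) = s 0,
          if altProd s = 1 then (1 : ℝ) else 0 := by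
        rw [sub_eq_iff_eq_add, eta_eq_sum, zeta_eq_sum, show 2 * (n + 2) = 2 * n + 3 + 1 by ring,
          cyclicWords_eq_filter, Finset.sum_filter_add_sum_filter_not]
    _ = ∑ v ∈ reducedWords Y (2 * n + 1 + 1),
          ((q : ℝ) - if v (Fin.last _) ≠ v 0 then 1 else 0) *
            if altProd v⁻¹ = 1 then (1 : ℝ) else 0 := by
        rw [sum_reducedWords_last_eq_head]
        refine Finset.sum_congr rfl fun v hv => ?_
        have hmem := (mem_reducedWords.1 hv).1
        rw [← card_erase_inter_erase hY (hmem _) (hmem _), ← nsmul_eq_mul, ← Finset.sum_const]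
        refine Finset.sum_congr rfl fun a _ => ?_
        rw [altProd_cons_snoc_self heven]
        exact if_congr (by rw [mul_eq_one_iff_eq_inv, mul_eq_left]) rfl rfl
    _ = ∑ v ∈ reducedWords Y⁻¹ (2 * n + 1 + 1),
          ((q : ℝ) - if v (Fin.last _) ≠ v 0 then 1 else 0) * if altProd v = 1 then 1 else 0 := by
        simp only [sum_reducedWords_inv, Pi.inv_apply, ne_eq, inv_inj]
    _ = q * eta Y⁻¹ (n + 1) - zeta Y⁻¹ (n + 1) := by
        rw [eta_eq_sum, zeta_eq_sum, show 2 * (n + 1) = 2 * n + 1 + 1 by ring,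
          cyclicWords_eq_filter, Finset.sum_filter, Finset.mul_sum, ← Finset.sum_sub_distrib]
        simp only [sub_mul, ite_mul, one_mul, zero_mul]

open Classical in
lemma eta_inv : eta Y⁻¹ (n + 1) = eta Y (n + 1) := by
  induction n with
  | zero => rw [zero_add, ← zeta_one, ← zeta_one, zeta_inv Y 0]
  | succ n ih =>
    have hY' : Y⁻¹.card = q + 1 := by rwa [Finset.card_inv]
    have hsub := eta_sub_zeta n hY
    have hsub' := eta_sub_zeta n hY'
    rw [inv_inv] at hsub'
    rw [ih, zeta_inv] at hsub
    rw [zeta_inv] at hsub'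
    linarith

/-- A closed word with equal first and last letters is conjugate to the closed word without them,
and a closed word arises in this way `q - 1` or `q` times, according to whether it is cyclically
reduced. -/
lemma eta_succ : eta Y (n + 2) = zeta Y (n + 2) - zeta Y (n + 1) + q * eta Y (n + 1) := by
  classical
  have hsub := eta_sub_zeta n hY
  rw [eta_inv n hY, zeta_inv] at hsub
  linarith

lemma zeta_eq : zeta Y (n + 1) =
    reTrace (Polynomial.aeval (shiftedGram Y q) (Polynomial.dickson 1 ((q : ℝ) ^ 2) (n + 1))) +
      (q - 1) := by
  induction n with
  | zero =>
    rw [zero_add, zeta_one, Polynomial.dickson_one, Polynomial.aeval_X, shiftedGram_eq hY,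
      map_sub, map_smul, reTrace_one, smul_eq_mul, mul_one, sub_add_cancel, eta_eq_reTrace]
  | succ n ih =>
    have hdiff : reTrace (hSeq Y (2 * (n + 2)) - q • hSeq Y (2 * (n + 1))) = _ :=
      congrArg reTrace (hSeq_sub_eq_aeval_dickson hY n)
    rw [map_sub, map_nsmul, nsmul_eq_mul, ← eta_eq_reTrace, ← eta_eq_reTrace, eta_succ n hY,
      map_sub, map_sub] at hdiff
    linarith

end Counting

section Norm

variable {Γ : Type*} [Group Γ]

lemma trace_adjoint_mul (a b : MonoidAlgebra ℂ Γ) :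
    trace (adjoint a * b) = a.coeff.sum fun x c => starRingEnd ℂ c * b.coeff x := by
  rw [adjoint, Finsupp.sum_mul, trace, Finsupp.sum, MonoidAlgebra.coeff_sum]
  simp [Finsupp.sum]

lemma norm2_sq (a : MonoidAlgebra ℂ Γ) : norm2 a ^ 2 = reTrace (adjoint a * a) := by
  refine Real.sq_sqrt ?_
  rw [trace_adjoint_mul, Finsupp.sum, Complex.re_sum]
  exact Finset.sum_nonneg fun x _ => by
    rw [Complex.conj_mul', ← Complex.ofReal_pow, Complex.ofReal_re]
    positivity

variable {Y : Finset Γ} {q : ℕ} (hY : Y.card = q + 1) (n : ℕ)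
include hY

lemma norm2_hSeq_one_sq : norm2 (hSeq Y 1) ^ 2 = eta Y 1 + (q + 1) := by
  rw [norm2_sq, hSeq_one, adjoint_h_mul_h hY, map_add, map_nsmul, reTrace_one, eta_eq_reTrace]
  simp

lemma norm2_hSeq_sq_succ : norm2 (hSeq Y (n + 2)) ^ 2 =
    eta Y (n + 2) - eta Y (n + 1) + q * norm2 (hSeq Y (n + 1)) ^ 2 := by
  have hrec := congrArg reTrace (adjoint_hSeq_mul_hSeq_succ hY (Even.add_self n))
  rw [map_add, map_add, map_nsmul, reTrace_adjoint, reTrace_adjoint, ← norm2_sq, ← norm2_sq,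
    nsmul_eq_mul, show n + n + 2 = 2 * (n + 1) by ring, show n + n + 4 = 2 * (n + 2) by ring,
    ← eta_eq_reTrace, ← eta_eq_reTrace] at hrec
  linarith

lemma norm2_hSeq_sq_le : norm2 (hSeq Y (n + 1)) ^ 2 ≤ ((q + 1) * q ^ n) ^ 2 := by
  classical
  have hprod : adjoint (hSeq Y (n + 1)) * hSeq Y (n + 1) =
      ∑ p ∈ reducedWords Y (n + 1) ×ˢ reducedWords Y (n + 1),
        MonoidAlgebra.single ((altProd p.1)⁻¹ * altProd p.2) 1 := by
    simp only [hSeq, adjoint_sum, Finset.sum_mul_sum, adjoint_single, map_one,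
      MonoidAlgebra.single_mul_single, mul_one, Finset.sum_product]
  calc norm2 (hSeq Y (n + 1)) ^ 2
      = ∑ p ∈ reducedWords Y (n + 1) ×ˢ reducedWords Y (n + 1),
          if (altProd p.1)⁻¹ * altProd p.2 = 1 then (1 : ℝ) else 0 := by
        rw [norm2_sq, hprod, reTrace_sum_single]
    _ ≤ ∑ _p ∈ reducedWords Y (n + 1) ×ˢ reducedWords Y (n + 1), (1 : ℝ) :=
        Finset.sum_le_sum fun _ _ => by split_ifs <;> norm_num
    _ = ((q + 1) * q ^ n) ^ 2 := by
        simp [card_reducedWords hY, sq]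

lemma xi_one : xi Y q 1 = eta Y 1 := by
  rw [xi, norm2_hSeq_one_sq hY, Nat.sub_self, pow_zero, mul_one, add_sub_cancel_right]

lemma xi_succ : xi Y q (n + 2) = eta Y (n + 2) - eta Y (n + 1) + q * xi Y q (n + 1) := by
  rw [xi, xi, norm2_hSeq_sq_succ hY, Nat.add_sub_cancel, Nat.add_succ_sub_one, pow_succ]
  ring

lemma eta_le_xi (hq : 1 ≤ q) : eta Y (n + 1) ≤ xi Y q (n + 1) := by
  induction n with
  | zero => exact (xi_one hY).ge
  | succ n ih =>
    have hq' : (1 : ℝ) ≤ q := by exact_mod_cast hq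
    have hpos : 0 ≤ eta Y (n + 1) := (zeta_nonneg Y _).trans (zeta_le_eta Y _)
    have hmul : xi Y q (n + 1) ≤ q * xi Y q (n + 1) :=
      le_mul_of_one_le_left (hpos.trans ih) hq'
    rw [xi_succ hY]
    linarith

omit hY in
lemma xi_le_norm2_hSeq_sq : xi Y q n ≤ norm2 (hSeq Y n) ^ 2 :=
  sub_le_self _ (by positivity)

end Norm

/-! ### The left regular representation -/

section PositivePolynomial

open Polynomial (aeval)

lemma aeval_star_mul_self_nonneg {A : Type*} [CStarAlgebra A] [PartialOrder A] [StarOrderedRing A]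
    {a : A} {p : Polynomial ℝ} (hp : ∀ x ∈ Set.Icc 0 (‖a‖ ^ 2), 0 ≤ p.eval x) :
    0 ≤ aeval (star a * a) p := by
  have hpos : 0 ≤ star a * a := star_mul_self_nonneg a
  have hle : star a * a ≤ algebraMap ℝ A (‖a‖ ^ 2) := by
    rw [sq, ← CStarRing.norm_star_mul_self]
    exact (IsSelfAdjoint.star_mul_self a).le_algebraMap_norm_self
  rw [← cfc_polynomial p _ (IsSelfAdjoint.star_mul_self a)]
  exact cfc_nonneg fun x hx => hp x ⟨spectrum_nonneg_of_nonneg hpos hx,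
    (le_algebraMap_iff_spectrum_le (IsSelfAdjoint.star_mul_self a)).1 hle x hx⟩

end PositivePolynomial

/-- The Hilbert space `ℓ²(Γ)`. -/
abbrev EllTwo (Γ : Type*) : Type _ := lp (fun _ : Γ => ℂ) 2

section RegularRepresentation

variable {Γ : Type*}

lemma hasSum_norm_sq (f : EllTwo Γ) : HasSum (fun x => ‖f x‖ ^ 2) (‖f‖ ^ 2) := by
  simpa using lp.hasSum_norm (p := 2) (by norm_num) f

lemma memℓp_two {f : Γ → ℂ} (hf : Summable fun x => ‖f x‖ ^ 2) : Memℓp f 2 :=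
  (memℓp_gen_iff (by norm_num)).2 (by simpa using hf)

variable [Group Γ]

lemma hasSum_norm_sq_mul_left (g : Γ) (f : EllTwo Γ) :
    HasSum (fun x => ‖f (g⁻¹ * x)‖ ^ 2) (‖f‖ ^ 2) :=
  (Equiv.mulLeft g⁻¹).hasSum_iff.2 (hasSum_norm_sq f)

/-- Left translation by `g` on `ℓ²(Γ)`. -/
def leftReg (g : Γ) : EllTwo Γ →ₗᵢ[ℂ] EllTwo Γ where
  toFun f := ⟨fun x => f (g⁻¹ * x), memℓp_two (hasSum_norm_sq_mul_left g f).summable⟩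
  map_add' _ _ := rfl
  map_smul' _ _ := rfl
  norm_map' f := (pow_left_inj₀ (norm_nonneg _) (norm_nonneg _) two_ne_zero).1 <|
    (hasSum_norm_sq _).unique (hasSum_norm_sq_mul_left g f)

lemma leftReg_apply (g : Γ) (f : EllTwo Γ) (x : Γ) : leftReg g f x = f (g⁻¹ * x) := rfl

/-- The left regular representation as a homomorphism into the bounded operators, the form needed
to extend it to the group ring. -/
def leftRegHom : Γ →* (EllTwo Γ →L[ℂ] EllTwo Γ) where
  toFun g := (leftReg g).toContinuousLinearMap
  map_one' := by
    ext f x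
    simp [leftReg_apply]
  map_mul' g k := by
    ext f x
    simp [leftReg_apply, mul_assoc]

lemma leftReg_mul (g k : Γ) (f : EllTwo Γ) : leftReg (g * k) f = leftReg g (leftReg k f) :=
  DFunLike.congr_fun (leftRegHom.map_mul g k) f

lemma leftReg_one (f : EllTwo Γ) : leftReg (1 : Γ) f = f :=
  DFunLike.congr_fun (leftRegHom.map_one (M := Γ)) f

lemma inner_leftReg_inv (g : Γ) (f k : EllTwo Γ) :
    inner ℂ (leftReg g⁻¹ f) k = inner ℂ f (leftReg g k) := by
  rw [← (leftReg g).inner_map_map, ← leftReg_mul, mul_inv_cancel, leftReg_one]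

lemma norm_leftReg_sub_leftReg (s t : Γ) (f : EllTwo Γ) :
    ‖leftReg s f - leftReg t f‖ = ‖leftReg (t⁻¹ * s) f - f‖ := by
  rw [← (leftReg t).norm_map (leftReg (t⁻¹ * s) f - f), map_sub, ← leftReg_mul,
    mul_inv_cancel_left]

open Classical in
lemma leftReg_single (g x : Γ) (c : ℂ) :
    leftReg g (lp.single 2 x c) = lp.single 2 (g * x) c := by
  ext y
  simp only [leftReg_apply, lp.single_apply, Pi.single_apply, inv_mul_eq_iff_eq_mul]

/-- The left regular representation `λ` of the group ring on `ℓ²(Γ)`. -/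
def regRep : MonoidAlgebra ℂ Γ →ₐ[ℂ] (EllTwo Γ →L[ℂ] EllTwo Γ) :=
  MonoidAlgebra.lift ℂ _ Γ leftRegHom

lemma regRep_single (g : Γ) (c : ℂ) (f : EllTwo Γ) :
    regRep (MonoidAlgebra.single g c) f = c • leftReg g f := by
  simp [regRep, MonoidAlgebra.lift_single, leftRegHom]

lemma regRep_adjoint (a : MonoidAlgebra ℂ Γ) : regRep (adjoint a) = star (regRep a) := by
  induction a using MonoidAlgebra.induction_linear with
  | zero => rw [adjoint_zero, map_zero, star_zero]
  | add a b ha hb => rw [adjoint_add, map_add, ha, hb, map_add, star_add]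
  | single g c =>
    rw [adjoint_single, ContinuousLinearMap.star_eq_adjoint, ContinuousLinearMap.eq_adjoint_iff]
    intro f k
    rw [regRep_single, regRep_single, inner_smul_left, inner_smul_right, inner_leftReg_inv,
      Complex.conj_conj]

lemma regRep_aeval (a : MonoidAlgebra ℂ Γ) (p : Polynomial ℝ) :
    regRep (Polynomial.aeval (adjoint a * a) p) =
      Polynomial.aeval (star (regRep a) * regRep a) p := by
  rw [← regRep_adjoint, ← map_mul]
  exact (Polynomial.aeval_algHom_apply (regRep.restrictScalars ℝ) _ p).symm

lemma regRep_h_apply (Y : Finset Γ) (f : EllTwo Γ) : regRep (h Y) f = ∑ s ∈ Y, leftReg s f := by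
  simp [h, regRep_single, _root_.sum_apply]

lemma norm_regRep_h_le (Y : Finset Γ) : ‖regRep (h Y)‖ ≤ Y.card := by
  refine ContinuousLinearMap.opNorm_le_bound _ Y.card.cast_nonneg fun f => ?_
  rw [regRep_h_apply]
  exact (norm_sum_le _ _).trans (by simp)

open Classical in
lemma inner_single_regRep_single (a : MonoidAlgebra ℂ Γ) (x : Γ) :
    inner ℂ (lp.single 2 x (1 : ℂ)) (regRep a (lp.single 2 x 1)) = trace a := by
  induction a using MonoidAlgebra.induction_linear with
  | zero => simp [trace]
  | add a b ha hb => simp [trace, ha, hb]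
  | single g c =>
    rw [regRep_single, leftReg_single, inner_smul_right, lp.inner_single_left, lp.single_apply,
      Pi.single_apply, trace, MonoidAlgebra.coeff_single, Finsupp.single_apply]
    simp

lemma reTrace_aeval_nonneg {a : MonoidAlgebra ℂ Γ} {p : Polynomial ℝ}
    (hp : ∀ x ∈ Set.Icc 0 (‖regRep a‖ ^ 2), 0 ≤ p.eval x) :
    0 ≤ reTrace (Polynomial.aeval (adjoint a * a) p) := by
  classical
  rw [reTrace_apply, ← inner_single_regRep_single _ 1, regRep_aeval]
  exact ((ContinuousLinearMap.nonneg_iff_isPositive _).1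
    (aeval_star_mul_self_nonneg hp)).re_inner_nonneg_right _

lemma reTrace_aeval_le {a : MonoidAlgebra ℂ Γ} {p : Polynomial ℝ} {C : ℝ}
    (hp : ∀ x ∈ Set.Icc 0 (‖regRep a‖ ^ 2), p.eval x ≤ C) :
    reTrace (Polynomial.aeval (adjoint a * a) p) ≤ C := by
  have hpos := reTrace_aeval_nonneg (a := a) (p := Polynomial.C C - p) fun x hx => by
    simpa using hp x hx
  simpa [Algebra.algebraMap_eq_smul_one, reTrace_one] using hpos

lemma moment_eq_reTrace_aeval (Y : Finset Γ) (n : ℕ) :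
    moment Y n = reTrace (Polynomial.aeval (adjoint (h Y) * h Y) (Polynomial.X ^ n : Polynomial ℝ))
    := by
  simp [moment, reTrace_apply]

lemma moment_nonneg (Y : Finset Γ) (n : ℕ) : 0 ≤ moment Y n := by
  rw [moment_eq_reTrace_aeval]
  exact reTrace_aeval_nonneg fun x hx => by simpa using pow_nonneg hx.1 n

lemma moment_le (Y : Finset Γ) (n : ℕ) : moment Y n ≤ (‖regRep (h Y)‖ ^ 2) ^ n := by
  rw [moment_eq_reTrace_aeval]
  exact reTrace_aeval_le fun x hx => by simpa using pow_le_pow_left₀ hx.1 hx.2 n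

end RegularRepresentation

/-! ### Almost invariant vectors and invariant means -/

section InnerProductSpace

lemma norm_sub_sq_le_of_card_sub_le_norm_sum (𝕜 : Type*) {E ι : Type*} [RCLike 𝕜]
    [NormedAddCommGroup E] [InnerProductSpace 𝕜 E] {s : Finset ι} {u : ι → E}
    (hu : ∀ i, ‖u i‖ = 1) {ε : ℝ} (hε : s.card - ε ≤ ‖∑ i ∈ s, u i‖) {i j : ι} (hi : i ∈ s)
    (hj : j ∈ s) : ‖u i - u j‖ ^ 2 ≤ 4 * ε := by
  classical
  have hnorm_sum (t : Finset ι) : ‖∑ i ∈ t, u i‖ ≤ t.card := by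
    simpa [hu] using norm_sum_le t u
  rcases eq_or_ne i j with rfl | hij
  · have := hnorm_sum s
    simp only [sub_self, norm_zero]
    linarith
  have hj' : j ∈ s.erase i := Finset.mem_erase.2 ⟨hij.symm, hj⟩
  have hcard : (((s.erase i).erase j).card : ℝ) = s.card - 2 := by
    rw [Finset.cast_card_erase_of_mem hj', Finset.cast_card_erase_of_mem hi]
    ring
  have hadd : 2 - ε ≤ ‖u i + u j‖ := by
    rw [← Finset.add_sum_erase _ _ hi, ← Finset.add_sum_erase _ _ hj', ← add_assoc] at hε
    linarith [norm_add_le (u i + u j) (∑ x ∈ (s.erase i).erase j, u x),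
      hnorm_sum ((s.erase i).erase j)]
  have hpar := parallelogram_law_with_norm 𝕜 (u i) (u j)
  rw [hu, hu] at hpar
  nlinarith [norm_nonneg (u i - u j), sq_nonneg (‖u i + u j‖ - 2)]

variable {𝕜 E : Type*} [RCLike 𝕜] [NormedAddCommGroup E] [InnerProductSpace 𝕜 E]

lemma abs_reApplyInnerSelf_le (T : E →L[𝕜] E) (f : E) :
    |T.reApplyInnerSelf f| ≤ ‖T‖ * ‖f‖ ^ 2 :=
  calc |T.reApplyInnerSelf f| ≤ ‖T f‖ * ‖f‖ :=
        (RCLike.abs_re_le_norm _).trans (norm_inner_le_norm _ _)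
    _ ≤ ‖T‖ * ‖f‖ * ‖f‖ := by gcongr; exact T.le_opNorm f
    _ = ‖T‖ * ‖f‖ ^ 2 := by ring

lemma exists_norm_eq_one_lt_norm_apply (T : E →L[𝕜] E) {r : ℝ} (hr₀ : 0 ≤ r) (hr : r < ‖T‖) :
    ∃ f : E, ‖f‖ = 1 ∧ r < ‖T f‖ := by
  lift r to NNReal using hr₀
  obtain ⟨f, hf, hTf⟩ := T.exists_nnnorm_eq_one_lt_apply_of_lt_opNNNorm hr
  exact ⟨f, congrArg NNReal.toReal hf, hTf⟩

lemma abs_reApplyInnerSelf_sub_le (T : E →L[𝕜] E) (f g : E) :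
    |T.reApplyInnerSelf f - T.reApplyInnerSelf g| ≤ ‖T‖ * (‖f‖ + ‖g‖) * ‖f - g‖ := by
  have hsplit : T.reApplyInnerSelf f - T.reApplyInnerSelf g =
      RCLike.re (inner 𝕜 (T f) (f - g)) + RCLike.re (inner 𝕜 (T (f - g)) g) := by
    simp only [ContinuousLinearMap.reApplyInnerSelf_apply, map_sub, inner_sub_left, inner_sub_right]
    ring
  have hinner (u v : E) : |RCLike.re (inner 𝕜 (T u) v)| ≤ ‖T‖ * ‖u‖ * ‖v‖ :=
    (RCLike.abs_re_le_norm _).trans <| (norm_inner_le_norm _ _).trans <| by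
      gcongr; exact T.le_opNorm u
  rw [hsplit]
  refine (abs_add_le _ _).trans ((add_le_add (hinner _ _) (hinner _ _)).trans_eq ?_)
  ring

end InnerProductSpace

section InvariantMean

variable {Γ : Type*}

lemma norm_mul_sq_le (φ : lp (fun _ : Γ => ℝ) ∞) (f : EllTwo Γ) (x : Γ) :
    ‖(φ x : ℂ) * f x‖ ^ 2 ≤ ‖φ‖ ^ 2 * ‖f x‖ ^ 2 := by
  rw [norm_mul, mul_pow, Complex.norm_real]
  gcongr
  exact lp.norm_apply_le_norm ENNReal.top_ne_zero φ x

lemma summable_norm_mul_sq (φ : lp (fun _ : Γ => ℝ) ∞) (f : EllTwo Γ) :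
    Summable fun x => ‖(φ x : ℂ) * f x‖ ^ 2 :=
  ((hasSum_norm_sq f).summable.mul_left _).of_nonneg_of_le (fun _ => sq_nonneg _)
    (norm_mul_sq_le φ f)

/-- Multiplication by the bounded function `φ`, as a linear map on `ℓ²(Γ)`. -/
def mulLin (φ : lp (fun _ : Γ => ℝ) ∞) : EllTwo Γ →ₗ[ℂ] EllTwo Γ where
  toFun f := ⟨fun x => φ x * f x, memℓp_two (summable_norm_mul_sq φ f)⟩
  map_add' _ _ := lp.ext <| funext fun _ => mul_add _ _ _
  map_smul' _ _ := lp.ext <| funext fun _ => mul_left_comm _ _ _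

lemma norm_mulLin_le (φ : lp (fun _ : Γ => ℝ) ∞) (f : EllTwo Γ) : ‖mulLin φ f‖ ≤ ‖φ‖ * ‖f‖ := by
  refine le_of_sq_le_sq ?_ (by positivity)
  rw [mul_pow]
  exact hasSum_le (norm_mul_sq_le φ f) (hasSum_norm_sq (mulLin φ f))
    ((hasSum_norm_sq f).mul_left _)

/-- Multiplication by the bounded function `φ`, as a bounded operator on `ℓ²(Γ)`. -/
def mulOp (φ : lp (fun _ : Γ => ℝ) ∞) : EllTwo Γ →L[ℂ] EllTwo Γ :=
  (mulLin φ).mkContinuous ‖φ‖ (norm_mulLin_le φ)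

lemma mulOp_apply (φ : lp (fun _ : Γ => ℝ) ∞) (f : EllTwo Γ) (x : Γ) :
    mulOp φ f x = φ x * f x := rfl

lemma norm_mulOp_le (φ : lp (fun _ : Γ => ℝ) ∞) : ‖mulOp φ‖ ≤ ‖φ‖ :=
  LinearMap.mkContinuous_norm_le _ (norm_nonneg _) _

/-- The average of the bounded function `φ` with respect to the density `|f|²`. -/
def avg (f : EllTwo Γ) (φ : lp (fun _ : Γ => ℝ) ∞) : ℝ := (mulOp φ).reApplyInnerSelf f

lemma hasSum_avg (f : EllTwo Γ) (φ : lp (fun _ : Γ => ℝ) ∞) :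
    HasSum (fun x => φ x * ‖f x‖ ^ 2) (avg f φ) := by
  have hre := Complex.hasSum_re (lp.hasSum_inner (𝕜 := ℂ) (mulOp φ f) f)
  have hcoord (x : Γ) : (inner ℂ (mulOp φ f x) (f x)).re = φ x * ‖f x‖ ^ 2 := by
    rw [mulOp_apply, RCLike.inner_apply', map_mul, Complex.conj_ofReal, mul_assoc,
      ← Complex.normSq_eq_conj_mul_self, ← Complex.ofReal_mul, Complex.ofReal_re,
      Complex.normSq_eq_norm_sq]
  simp only [hcoord] at hre
  exact hre

lemma avg_add (f : EllTwo Γ) (φ ψ : lp (fun _ : Γ => ℝ) ∞) :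
    avg f (φ + ψ) = avg f φ + avg f ψ :=
  (hasSum_avg f _).unique <| by
    simpa [add_mul] using (hasSum_avg f φ).add (hasSum_avg f ψ)

lemma avg_smul (f : EllTwo Γ) (c : ℝ) (φ : lp (fun _ : Γ => ℝ) ∞) :
    avg f (c • φ) = c * avg f φ :=
  (hasSum_avg f _).unique <| by simpa [mul_assoc] using (hasSum_avg f φ).mul_left c

lemma avg_nonneg (f : EllTwo Γ) {φ : lp (fun _ : Γ => ℝ) ∞} (hφ : ∀ x, 0 ≤ φ x) :
    0 ≤ avg f φ :=
  (hasSum_avg f φ).nonneg fun x => mul_nonneg (hφ x) (sq_nonneg _)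

lemma avg_one (f : EllTwo Γ) : avg f 1 = ‖f‖ ^ 2 :=
  (hasSum_avg f 1).unique <| by simpa using hasSum_norm_sq f

lemma avg_leftTranslate [Group Γ] (g : Γ) (f : EllTwo Γ) (φ : lp (fun _ : Γ => ℝ) ∞) :
    avg f (leftTranslate g φ) = avg (leftReg g⁻¹ f) φ := by
  refine (hasSum_avg f _).unique ((Equiv.mulLeft g).hasSum_iff.1 ?_)
  simpa [Function.comp_def, leftTranslate, leftReg_apply] using hasSum_avg (leftReg g⁻¹ f) φ

lemma abs_avg_le (f : EllTwo Γ) (φ : lp (fun _ : Γ => ℝ) ∞) : |avg f φ| ≤ ‖φ‖ * ‖f‖ ^ 2 :=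
  (abs_reApplyInnerSelf_le _ f).trans (by have := norm_mulOp_le φ; gcongr)

lemma abs_avg_sub_avg_le (f g : EllTwo Γ) (φ : lp (fun _ : Γ => ℝ) ∞) :
    |avg f φ - avg g φ| ≤ ‖φ‖ * (‖f‖ + ‖g‖) * ‖f - g‖ :=
  (abs_reApplyInnerSelf_sub_le _ f g).trans (by have := norm_mulOp_le φ; gcongr)

lemma exists_tendsto_avg {ι : Type*} (U : Ultrafilter ι) {f : ι → EllTwo Γ} (hf : ∀ i, ‖f i‖ = 1)
    (φ : lp (fun _ : Γ => ℝ) ∞) : ∃ c, Tendsto (fun i => avg (f i) φ) U (𝓝 c) := by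
  have hmem (i : ι) : avg (f i) φ ∈ Set.Icc (-‖φ‖) ‖φ‖ := by
    simpa [hf, abs_le] using abs_avg_le (f i) φ
  obtain ⟨c, -, hc⟩ := isCompact_Icc.ultrafilter_le_nhds' (U.map fun i => avg (f i) φ)
    (Filter.mem_map.2 (Filter.univ_mem' hmem))
  exact ⟨c, hc⟩

variable [Group Γ]

lemma tendsto_norm_leftReg_sub_of_mem_closure {ι : Type*} {l : Filter ι} {f : ι → EllTwo Γ}
    {S : Set Γ} (hS : ∀ g ∈ S, Tendsto (fun i => ‖leftReg g (f i) - f i‖) l (𝓝 0)) {g : Γ}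
    (hg : g ∈ Subgroup.closure S) : Tendsto (fun i => ‖leftReg g (f i) - f i‖) l (𝓝 0) := by
  induction hg using Subgroup.closure_induction with
  | mem g hg => exact hS g hg
  | one => simpa only [leftReg_one, sub_self, norm_zero] using tendsto_const_nhds
  | mul g k _ _ hg hk =>
    refine squeeze_zero (fun _ => norm_nonneg _) (fun i => ?_) (by simpa using hk.add hg)
    rw [leftReg_mul, ← (leftReg g).norm_map (leftReg k (f i) - f i), map_sub]
    exact norm_sub_le_norm_sub_add_norm_sub _ _ _
  | inv g _ hg =>
    refine hg.congr fun i => ?_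
    rw [← (leftReg g⁻¹).norm_map, map_sub, ← leftReg_mul, inv_mul_cancel, leftReg_one, norm_sub_rev]

lemma amenable_of_tendsto_norm_leftReg_sub {ι : Type*} {l : Filter ι} [l.NeBot]
    {f : ι → EllTwo Γ} (hf : ∀ i, ‖f i‖ = 1)
    (hinv : ∀ g, Tendsto (fun i => ‖leftReg g (f i) - f i‖) l (𝓝 0)) : Amenable Γ := by
  choose m hm using exists_tendsto_avg (Ultrafilter.of l) hf
  have hlim {φ : lp (fun _ : Γ => ℝ) ∞} {c : ℝ}
      (hc : Tendsto (fun i => avg (f i) φ) (Ultrafilter.of l) (𝓝 c)) : m φ = c :=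
    tendsto_nhds_unique (hm φ) hc
  refine ⟨⟨⟨m, fun φ ψ => hlim ?_⟩, fun c φ => hlim ?_⟩, fun φ hφ => ?_, hlim ?_, fun g φ => ?_⟩
  · simpa only [avg_add] using (hm φ).add (hm ψ)
  · simpa only [avg_smul, RingHom.id_apply, smul_eq_mul] using (hm φ).const_mul c
  · exact ge_of_tendsto' (hm φ) fun i => avg_nonneg (f i) hφ
  · simpa only [avg_one, hf, one_pow] using tendsto_const_nhds
  · have hdiff : Tendsto (fun i => avg (f i) (leftTranslate g φ) - avg (f i) φ) l (𝓝 0) := by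
      refine squeeze_zero_norm (fun i => ?_) (by simpa using (hinv g⁻¹).const_mul (‖φ‖ * 2))
      simpa [avg_leftTranslate, hf, one_add_one_eq_two] using
        abs_avg_sub_avg_le (leftReg g⁻¹ (f i)) (f i) φ
    refine hlim ?_
    simpa using (hdiff.mono_left (Ultrafilter.of_le l)).add (hm φ)

lemma norm_leftReg_inv_mul_sub_sq_le {Y : Finset Γ} {f : EllTwo Γ} (hf : ‖f‖ = 1) {ε : ℝ}
    (hε : Y.card - ε ≤ ‖regRep (h Y) f‖) {s t : Γ} (hs : s ∈ Y) (ht : t ∈ Y) :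
    ‖leftReg (s⁻¹ * t) f - f‖ ^ 2 ≤ 4 * ε := by
  rw [regRep_h_apply] at hε
  rw [← norm_leftReg_sub_leftReg]
  exact norm_sub_sq_le_of_card_sub_le_norm_sum ℂ (fun s => ((leftReg s).norm_map f).trans hf) hε
    ht hs

lemma amenable_of_card_le_norm {Y : Finset Γ} (hne : Y.Nonempty)
    (hgen : Subgroup.closure ((Y : Set Γ)⁻¹ * (Y : Set Γ)) = ⊤)
    (hnorm : Y.card ≤ ‖regRep (h Y)‖) : Amenable Γ := by
  have hex (k : ℕ) : ∃ f : EllTwo Γ, ‖f‖ = 1 ∧ Y.card - 1 / ((k : ℝ) + 1) ≤ ‖regRep (h Y) f‖ := by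
    have hk : 0 < 1 / ((k : ℝ) + 1) ∧ 1 / ((k : ℝ) + 1) ≤ 1 :=
      ⟨Nat.one_div_pos_of_nat, (div_le_one₀ (by positivity)).2 (by simp)⟩
    have hcard : (1 : ℝ) ≤ Y.card := by exact_mod_cast hne.card_pos
    obtain ⟨f, hf, hmax⟩ := exists_norm_eq_one_lt_norm_apply (regRep (h Y))
      (r := Y.card - 1 / ((k : ℝ) + 1)) (by linarith) (by linarith)
    exact ⟨f, hf, hmax.le⟩
  choose f hf hmax using hex
  refine amenable_of_tendsto_norm_leftReg_sub (l := atTop) hf fun g => ?_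
  refine tendsto_norm_leftReg_sub_of_mem_closure ?_ (hgen ▸ Subgroup.mem_top g)
  rintro _ ⟨s, hs, t, ht, rfl⟩
  have hle (k : ℕ) : ‖leftReg (s * t) (f k) - f k‖ ≤ √(4 * (1 / ((k : ℝ) + 1))) := by
    refine Real.le_sqrt_of_sq_le ?_
    simpa using norm_leftReg_inv_mul_sub_sq_le (hf k) (hmax k) (Set.mem_inv.1 hs) ht
  refine squeeze_zero (fun _ => norm_nonneg _) hle ?_
  simpa using (tendsto_one_div_add_atTop_nhds_zero_nat (𝕜 := ℝ)).const_mul 4 |>.sqrt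

end InvariantMean

/-! ### Almost invariant densities in amenable groups -/

section Reiter

variable {Γ : Type*}

lemma zero_mem_closure_of_mean {E : Type*} [NormedAddCommGroup E] [NormedSpace ℝ E]
    {m : lp (fun _ : Γ => ℝ) ∞ →ₗ[ℝ] ℝ}
    (hpos : ∀ φ : lp (fun _ : Γ => ℝ) ∞, (∀ x, 0 ≤ φ x) → 0 ≤ m φ)
    (hone : m 1 = 1) {C : Set E} (hC : Convex ℝ C) {v : Γ → E} (hvC : ∀ x, v x ∈ C)
    (hv : ∀ Φ : E →L[ℝ] ℝ, ∃ φ : lp (fun _ : Γ => ℝ) ∞, (∀ x, φ x = Φ (v x)) ∧ m φ = 0) :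
    0 ∈ closure C := by
  by_contra h0
  obtain ⟨Φ, u, hu0, hu⟩ := geometric_hahn_banach_point_closed hC.closure isClosed_closure h0
  rw [map_zero] at hu0
  obtain ⟨φ, hφ, hmφ⟩ := hv Φ
  have hle : 0 ≤ m (φ - u • 1) := hpos _ fun x => by
    change 0 ≤ φ x - u * 1
    rw [hφ, mul_one]
    exact sub_nonneg.2 (hu _ (subset_closure (hvC x))).le
  rw [map_sub, map_smul, hmφ, hone, smul_eq_mul, mul_one] at hle
  linarith

/-- The finitely supported probability densities on `Γ`. -/
def probDensities (Γ : Type*) : Set (Γ →₀ ℝ) := {p | (∀ x, 0 ≤ p x) ∧ (p.sum fun _ c => c) = 1}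

lemma convex_probDensities : Convex ℝ (probDensities Γ) := by
  classical
  rintro p ⟨hp₀, hp₁⟩ r ⟨hr₀, hr₁⟩ a b ha hb hab
  refine ⟨fun x => add_nonneg (mul_nonneg ha (hp₀ x)) (mul_nonneg hb (hr₀ x)), ?_⟩
  rw [Finsupp.sum_add_index' (by simp) (by simp), Finsupp.sum_smul_index (by simp),
    Finsupp.sum_smul_index (by simp), ← Finsupp.mul_sum, ← Finsupp.mul_sum, hp₁, hr₁]
  simpa using hab

lemma single_mem_probDensities (x : Γ) : Finsupp.single x 1 ∈ probDensities Γ := by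
  classical
  refine ⟨fun y => ?_, by simp⟩
  rw [Finsupp.single_apply]
  split_ifs <;> norm_num

lemma hasSum_of_mem_probDensities {p : Γ →₀ ℝ} (hp : p ∈ probDensities Γ) : HasSum p 1 := by
  rw [← hp.2]
  exact hasSum_sum_of_ne_finset_zero fun x hx => by simpa using hx

variable [Group Γ]

open Classical in
/-- The boundary `∑_{g ∈ F} ∑_x p(x) (δ_{(g, g x)} - δ_{(g, x)})` in `ℓ¹(Γ × Γ)`: it records the
functions `g p - p` for all `g ∈ F` simultaneously. -/
def boundary (F : Finset Γ) : (Γ →₀ ℝ) →ₗ[ℝ] lp (fun _ : Γ × Γ => ℝ) 1 :=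
  Finsupp.linearCombination ℝ fun x =>
    ∑ g ∈ F, (lp.single 1 (g, g * x) (1 : ℝ) - lp.single 1 (g, x) (1 : ℝ))

lemma boundary_apply {F : Finset Γ} (p : Γ →₀ ℝ) {g : Γ} (hg : g ∈ F) (x : Γ) :
    boundary F p (g, x) = p (g⁻¹ * x) - p x := by
  classical
  induction p using Finsupp.induction_linear with
  | zero => simp
  | add p₁ p₂ h₁ h₂ =>
    rw [map_add, lp.coeFn_add, Pi.add_apply, h₁, h₂, Finsupp.add_apply, Finsupp.add_apply]
    ring
  | single y c =>
    rw [boundary, Finsupp.linearCombination_single, lp.coeFn_smul, Pi.smul_apply, lp.coeFn_sum,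
      Finset.sum_apply, Finset.sum_eq_single_of_mem g hg]
    · simp [lp.single_apply, Pi.single_apply, Finsupp.single_apply, mul_sub,
        eq_inv_mul_iff_mul_eq, eq_comm]
    · intro b _ hb
      simp [lp.single_apply, hb.symm]

open Classical in
/-- The coefficients `x ↦ Φ(δ_{(g, x)})` of a functional on `ℓ¹(Γ × Γ)`. -/
def coeffFun (Φ : lp (fun _ : Γ × Γ => ℝ) 1 →L[ℝ] ℝ) (g : Γ) : lp (fun _ : Γ => ℝ) ∞ :=
  ⟨fun x => Φ (lp.single 1 (g, x) 1), memℓp_infty ⟨‖Φ‖, by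
    rintro _ ⟨x, rfl⟩
    simpa [lp.norm_single] using Φ.le_opNorm (lp.single 1 (g, x) 1)⟩⟩

lemma exists_norm_boundary_lt (hΓ : Amenable Γ) (F : Finset Γ) {ε : ℝ} (hε : 0 < ε) :
    ∃ p ∈ probDensities Γ, ‖boundary F p‖ < ε := by
  obtain ⟨m, hpos, hone, hinv⟩ := hΓ
  have hzero : 0 ∈ closure (boundary F '' probDensities Γ) := by
    refine zero_mem_closure_of_mean hpos hone (convex_probDensities.linear_image (boundary F))
      (fun x => Set.mem_image_of_mem _ (single_mem_probDensities x)) fun Φ =>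
      ⟨∑ g ∈ F, (leftTranslate g⁻¹ (coeffFun Φ g) - coeffFun Φ g), fun x => ?_, ?_⟩
    · rw [boundary, Finsupp.linearCombination_single, one_smul, map_sum, lp.coeFn_sum,
        Finset.sum_apply]
      refine Finset.sum_congr rfl fun g _ => ?_
      rw [map_sub, lp.coeFn_sub, Pi.sub_apply]
      simp [leftTranslate, coeffFun]
    · simp only [map_sum, map_sub, hinv, sub_self, Finset.sum_const_zero]
  obtain ⟨_, ⟨p, hp, rfl⟩, hlt⟩ := Metric.mem_closure_iff.1 hzero ε hε
  exact ⟨p, hp, by rwa [dist_zero_left] at hlt⟩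

end Reiter

section SquareRoot

variable {Γ : Type*}

open Classical in
/-- The pointwise square root of `p` as a vector in `ℓ²(Γ)`. -/
def sqrtVec (p : Γ →₀ ℝ) : EllTwo Γ := ∑ x ∈ p.support, (√(p x) : ℂ) • lp.single 2 x 1

lemma sqrtVec_apply (p : Γ →₀ ℝ) (x : Γ) : sqrtVec p x = √(p x) := by
  classical
  rw [sqrtVec, lp.coeFn_sum, Finset.sum_apply]
  simp only [lp.coeFn_smul, Pi.smul_apply, lp.single_apply, smul_eq_mul, Pi.single_apply]
  simp +contextual

lemma norm_sqrtVec {p : Γ →₀ ℝ} (hp : p ∈ probDensities Γ) : ‖sqrtVec p‖ = 1 := by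
  have hsum := hasSum_norm_sq (sqrtVec p)
  simp only [sqrtVec_apply, Complex.norm_real, Real.norm_eq_abs, sq_abs, Real.sq_sqrt (hp.1 _)]
    at hsum
  exact (pow_eq_one_iff_of_nonneg (norm_nonneg _) two_ne_zero).1
    (hsum.unique (hasSum_of_mem_probDensities hp))

lemma one_le_sum_sqrt {p : Γ →₀ ℝ} (hp : p ∈ probDensities Γ) : 1 ≤ ∑ x ∈ p.support, √(p x) := by
  classical
  rw [← norm_sqrtVec hp]
  refine (norm_sum_le _ _).trans_eq (Finset.sum_congr rfl fun x _ => ?_)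
  rw [norm_smul, lp.norm_single (by norm_num), norm_one, mul_one, Complex.norm_real,
    Real.norm_of_nonneg (Real.sqrt_nonneg _)]

lemma sqrt_sub_sqrt_sq_le {a b : ℝ} (ha : 0 ≤ a) (hb : 0 ≤ b) : (√a - √b) ^ 2 ≤ |a - b| := by
  have hfactor : |a - b| = |√a - √b| * (√a + √b) := by
    rw [← abs_of_nonneg (by positivity : 0 ≤ √a + √b), ← abs_mul]
    congr 1
    nlinarith [Real.sq_sqrt ha, Real.sq_sqrt hb]
  rw [hfactor, ← sq_abs, sq]
  gcongr
  rw [abs_le]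
  constructor <;> linarith [Real.sqrt_nonneg a, Real.sqrt_nonneg b]

variable [Group Γ]

lemma norm_leftReg_sqrtVec_sub_sq_le {F : Finset Γ} {g : Γ} (hg : g ∈ F) {p : Γ →₀ ℝ}
    (hp : p ∈ probDensities Γ) : ‖leftReg g (sqrtVec p) - sqrtVec p‖ ^ 2 ≤ ‖boundary F p‖ := by
  classical
  refine hasSum_le_of_sum_le (hasSum_norm_sq (leftReg g (sqrtVec p) - sqrtVec p)) fun s => ?_
  have hbound : ∑ x ∈ s, ‖boundary F p (g, x)‖ ≤ ‖boundary F p‖ := by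
    simpa using lp.sum_rpow_le_norm_rpow (p := 1) (by norm_num) (boundary F p)
      (s.image fun x => (g, x))
  refine (Finset.sum_le_sum fun x _ => ?_).trans hbound
  rw [boundary_apply p hg, lp.coeFn_sub, Pi.sub_apply, leftReg_apply, sqrtVec_apply, sqrtVec_apply,
    ← Complex.ofReal_sub, Complex.norm_real, Real.norm_eq_abs, sq_abs]
  exact sqrt_sub_sqrt_sq_le (hp.1 _) (hp.1 _)

lemma exists_norm_leftReg_sqrtVec_sub_lt (hΓ : Amenable Γ) (F : Finset Γ) {ε : ℝ} (hε : 0 < ε) :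
    ∃ p ∈ probDensities Γ, ∀ g ∈ F, ‖leftReg g (sqrtVec p) - sqrtVec p‖ < ε := by
  obtain ⟨p, hp, hlt⟩ := exists_norm_boundary_lt hΓ F (pow_pos hε 2)
  exact ⟨p, hp, fun g hg =>
    lt_of_pow_lt_pow_left₀ 2 hε.le ((norm_leftReg_sqrtVec_sub_sq_le hg hp).trans_lt hlt)⟩

lemma exists_lt_norm_regRep_sqrtVec (hΓ : Amenable Γ) {Y : Finset Γ} (hne : Y.Nonempty) {r : ℝ}
    (hr : r < Y.card) : ∃ p ∈ probDensities Γ, r < ‖regRep (h Y) (sqrtVec p)‖ := by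
  classical
  have hcard : (0 : ℝ) < Y.card := by exact_mod_cast hne.card_pos
  obtain ⟨p, hp, hinv⟩ := exists_norm_leftReg_sqrtVec_sub_lt hΓ Y
    (div_pos (sub_pos.2 hr) hcard)
  refine ⟨p, hp, ?_⟩
  have hdist : ‖(Y.card : ℂ) • sqrtVec p - regRep (h Y) (sqrtVec p)‖ < Y.card - r := by
    calc ‖(Y.card : ℂ) • sqrtVec p - regRep (h Y) (sqrtVec p)‖
        = ‖∑ s ∈ Y, (sqrtVec p - leftReg s (sqrtVec p))‖ := by
          rw [regRep_h_apply, Finset.sum_sub_distrib, Finset.sum_const, Nat.cast_smul_eq_nsmul]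
      _ ≤ ∑ s ∈ Y, ‖leftReg s (sqrtVec p) - sqrtVec p‖ :=
          (norm_sum_le _ _).trans_eq (Finset.sum_congr rfl fun s _ => norm_sub_rev _ _)
      _ < ∑ _s ∈ Y, (Y.card - r) / Y.card := Finset.sum_lt_sum_of_nonempty hne hinv
      _ = Y.card - r := by
          rw [Finset.sum_const, nsmul_eq_mul, mul_div_cancel₀ _ hcard.ne']
  have hnorm : ‖(Y.card : ℂ) • sqrtVec p‖ = Y.card := by
    rw [norm_smul, norm_sqrtVec hp, mul_one, Complex.norm_natCast]
  linarith [norm_sub_norm_le ((Y.card : ℂ) • sqrtVec p) (regRep (h Y) (sqrtVec p))]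

end SquareRoot

/-! ### The spectral distribution of `h^* h` near `|Y|²` -/

section PositiveOperator

variable {H : Type*} [NormedAddCommGroup H] [InnerProductSpace ℂ H] [CompleteSpace H]
  {T : H →L[ℂ] H}

omit [CompleteSpace H] in
lemma re_inner_le_of_re_inner_self_le (hT : 0 ≤ T) {u v : H} {M : ℝ}
    (hu : (inner ℂ u (T u)).re ≤ M) (hv : (inner ℂ v (T v)).re ≤ M) :
    (inner ℂ u (T v)).re ≤ M := by
  have hpos := (ContinuousLinearMap.nonneg_iff_isPositive T).1 hT
  have hsub : 0 ≤ (inner ℂ (u - v) (T (u - v))).re := hpos.re_inner_nonneg_right _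
  have hsymm : (inner ℂ v (T u)).re = (inner ℂ u (T v)).re := by
    rw [← hpos.isSymmetric.apply_clm v u]
    exact inner_re_symm (𝕜 := ℂ) _ _
  simp only [map_sub, inner_sub_left, inner_sub_right, Complex.sub_re] at hsub
  linarith

omit [CompleteSpace H] in
lemma re_inner_sum_le {ι : Type*} (hT : 0 ≤ T) (s : Finset ι) {c : ι → ℝ} (hc : ∀ i, 0 ≤ c i)
    {v : ι → H} {M : ℝ} (hv : ∀ i, (inner ℂ (v i) (T (v i))).re ≤ M) :
    (inner ℂ (∑ i ∈ s, (c i : ℂ) • v i) (T (∑ i ∈ s, (c i : ℂ) • v i))).re ≤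
      (∑ i ∈ s, c i) ^ 2 * M := by
  have hterm (i j : ι) : (inner ℂ ((c i : ℂ) • v i) (T ((c j : ℂ) • v j))).re ≤ c i * c j * M := by
    rw [map_smul, inner_smul_left, inner_smul_right, Complex.conj_ofReal, Complex.re_ofReal_mul,
      Complex.re_ofReal_mul, ← mul_assoc]
    exact mul_le_mul_of_nonneg_left (re_inner_le_of_re_inner_self_le hT (hv i) (hv j))
      (mul_nonneg (hc i) (hc j))
  calc (inner ℂ (∑ i ∈ s, (c i : ℂ) • v i) (T (∑ i ∈ s, (c i : ℂ) • v i))).re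
      = ∑ i ∈ s, ∑ j ∈ s, (inner ℂ ((c i : ℂ) • v i) (T ((c j : ℂ) • v j))).re := by
        simp only [map_sum, sum_inner, inner_sum, Complex.re_sum]
        exact Finset.sum_comm
    _ ≤ ∑ i ∈ s, ∑ j ∈ s, c i * c j * M :=
        Finset.sum_le_sum fun i _ => Finset.sum_le_sum fun j _ => hterm i j
    _ = (∑ i ∈ s, c i) ^ 2 * M := by
        rw [sq, Finset.sum_mul_sum, Finset.sum_mul]
        simp only [Finset.sum_mul]

lemma inner_star_mul_self_apply (f : H) : inner ℂ f ((star T * T) f) = (‖T f‖ ^ 2 : ℝ) := by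
  rw [mul_apply_eq_comp, ContinuousLinearMap.star_eq_adjoint,
    ContinuousLinearMap.adjoint_inner_right, inner_self_eq_norm_sq_to_K]
  simp

lemma mul_norm_sq_sub_le_re_inner_aeval {p : Polynomial ℝ} {c x₀ : ℝ}
    (hp : ∀ x ∈ Set.Icc 0 (‖T‖ ^ 2), c * (x - x₀) ≤ p.eval x) {f : H} (hf : ‖f‖ = 1) :
    c * (‖T f‖ ^ 2 - x₀) ≤ (inner ℂ f (Polynomial.aeval (star T * T) p f)).re := by
  set r := Polynomial.C c * (Polynomial.X - Polynomial.C x₀) with hr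
  have hpoly : 0 ≤ Polynomial.aeval (star T * T) (p - r) :=
    aeval_star_mul_self_nonneg fun x hx => by simpa [hr] using hp x hx
  have hform : 0 ≤ (inner ℂ f (Polynomial.aeval (star T * T) (p - r) f)).re :=
    ((ContinuousLinearMap.nonneg_iff_isPositive _).1 hpoly).re_inner_nonneg_right f
  have hff : inner ℂ f f = 1 := by
    rw [inner_self_eq_norm_sq_to_K, hf]
    simp
  simp only [hr, map_sub, map_mul, Polynomial.aeval_X, Polynomial.aeval_C,
    Algebra.algebraMap_eq_smul_one, smul_mul_assoc, one_mul, _root_.sub_apply, _root_.smul_apply,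
    one_apply_eq_self, inner_sub_right, inner_smul_right_eq_smul, Complex.sub_re, Complex.smul_re,
    hff, inner_star_mul_self_apply, Complex.ofReal_re, Complex.one_re, smul_eq_mul, mul_one]
    at hform
  linarith

end PositiveOperator

section SpectralGap

variable {Γ : Type*} [Group Γ] {Y : Finset Γ}

lemma div_sub_mul_sub_le {p : Polynomial ℝ} {N x₀ t x : ℝ} (hx₀ : x₀ < N) (ht : 0 ≤ t)
    (hp : ∀ x ∈ Set.Icc 0 N, 0 ≤ p.eval x) (hpt : ∀ x ∈ Set.Icc x₀ N, t ≤ p.eval x)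
    (hx : x ∈ Set.Icc 0 N) : t / (N - x₀) * (x - x₀) ≤ p.eval x := by
  have hslope : 0 ≤ t / (N - x₀) := div_nonneg ht (sub_pos.2 hx₀).le
  rcases le_total x x₀ with hxx₀ | hxx₀
  · exact (mul_nonpos_of_nonneg_of_nonpos hslope (sub_nonpos.2 hxx₀)).trans (hp x hx)
  · calc t / (N - x₀) * (x - x₀) ≤ t / (N - x₀) * (N - x₀) := by
          gcongr
          exact hx.2
      _ = t := div_mul_cancel₀ _ (sub_pos.2 hx₀).ne'
      _ ≤ p.eval x := hpt x ⟨hxx₀, hx.2⟩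

/-- The spectral measure of `h^* h` charges every neighbourhood of the point `|Y|²`. -/
lemma exists_pos_mul_le_reTrace_aeval (hΓ : Amenable Γ) (hne : Y.Nonempty) {x₀ : ℝ}
    (hx₀ : x₀ < (Y.card : ℝ) ^ 2) :
    ∃ d > 0, ∀ (p : Polynomial ℝ) (t : ℝ), 0 ≤ t →
      (∀ x ∈ Set.Icc 0 ((Y.card : ℝ) ^ 2), 0 ≤ p.eval x) →
      (∀ x ∈ Set.Icc x₀ ((Y.card : ℝ) ^ 2), t ≤ p.eval x) →
      d * t ≤ reTrace (Polynomial.aeval (adjoint (h Y) * h Y) p) := by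
  classical
  have hcard : (0 : ℝ) < Y.card := by exact_mod_cast hne.card_pos
  have hnorm : ‖regRep (h Y)‖ ^ 2 ≤ (Y.card : ℝ) ^ 2 := by
    gcongr; exact norm_regRep_h_le Y
  obtain ⟨ρ, hρ, hlt⟩ := exists_lt_norm_regRep_sqrtVec hΓ hne ((Real.sqrt_lt' hcard).2 hx₀)
  set a := ‖regRep (h Y) (sqrtVec ρ)‖ ^ 2
  have ha : x₀ < a := Real.lt_sq_of_sqrt_lt hlt
  set C := ∑ x ∈ ρ.support, √(ρ x)
  have hC : 0 < C := zero_lt_one.trans_le (one_le_sum_sqrt hρ)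
  refine ⟨(a - x₀) / ((Y.card ^ 2 - x₀) * C ^ 2),
    div_pos (sub_pos.2 ha) (mul_pos (sub_pos.2 hx₀) (pow_pos hC 2)), fun p t ht hp hpt => ?_⟩
  have hlow := mul_norm_sq_sub_le_re_inner_aeval (fun x hx =>
    div_sub_mul_sub_le hx₀ ht hp hpt ⟨hx.1, hx.2.trans hnorm⟩) (norm_sqrtVec hρ)
  have hpos : 0 ≤ Polynomial.aeval (star (regRep (h Y)) * regRep (h Y)) p :=
    aeval_star_mul_self_nonneg fun x hx => hp x ⟨hx.1, hx.2.trans hnorm⟩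
  have hupp := re_inner_sum_le hpos ρ.support (fun x => Real.sqrt_nonneg (ρ x))
    (v := fun x => lp.single 2 x (1 : ℂ))
    (M := reTrace (Polynomial.aeval (adjoint (h Y) * h Y) p)) fun x => le_of_eq <| by
      rw [← regRep_aeval, inner_single_regRep_single, reTrace_apply]
  calc (a - x₀) / ((Y.card ^ 2 - x₀) * C ^ 2) * t
      = t / (Y.card ^ 2 - x₀) * (a - x₀) / C ^ 2 := by field_simp
    _ ≤ reTrace (Polynomial.aeval (adjoint (h Y) * h Y) p) :=
        (div_le_iff₀' (pow_pos hC 2)).2 (hlow.trans hupp)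

lemma pow_isBigO_moment (hΓ : Amenable Γ) (hne : Y.Nonempty) {b : ℝ} (hb₀ : 0 ≤ b)
    (hb : b < (Y.card : ℝ) ^ 2) : (b ^ · : ℕ → ℝ) =O[atTop] moment Y := by
  obtain ⟨d, hd, hlow⟩ := exists_pos_mul_le_reTrace_aeval hΓ hne hb
  refine IsBigO.of_bound d⁻¹ (Eventually.of_forall fun n => ?_)
  rw [Real.norm_of_nonneg (pow_nonneg hb₀ n), Real.norm_of_nonneg (moment_nonneg Y n),
    le_inv_mul_iff₀ hd, moment_eq_reTrace_aeval]
  exact hlow _ _ (pow_nonneg hb₀ n) (fun x hx => by simpa using pow_nonneg hx.1 n)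
    fun x hx => by simpa using pow_le_pow_left₀ hb₀ hx.1 n

end SpectralGap

/-! ### Growth rates and amenability -/

section Cogrowth

variable {Γ : Type*} [Group Γ] {Y : Finset Γ}

lemma norm_regRep_h_lt (hne : Y.Nonempty)
    (hgen : Subgroup.closure ((Y : Set Γ)⁻¹ * (Y : Set Γ)) = ⊤) (hΓ : ¬ Amenable Γ) :
    ‖regRep (h Y)‖ < Y.card :=
  not_le.1 fun hnorm => hΓ (amenable_of_card_le_norm hne hgen hnorm)

theorem amenable_iff_tendsto_moment (hne : Y.Nonempty)
    (hgen : Subgroup.closure ((Y : Set Γ)⁻¹ * (Y : Set Γ)) = ⊤) :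
    Amenable Γ ↔ Tendsto (fun n : ℕ => moment Y n ^ (1 / (2 * (n : ℝ)))) atTop (𝓝 Y.card) := by
  have hcard : (0 : ℝ) < Y.card := by exact_mod_cast hne.card_pos
  have hnonneg : ∀ᶠ n in atTop, 0 ≤ moment Y n := .of_forall (moment_nonneg Y)
  have hupp {B : ℝ} (hB : ‖regRep (h Y)‖ ≤ B) : moment Y =O[atTop] ((B ^ 2) ^ · : ℕ → ℝ) :=
    isBigO_of_eventually_le hnonneg (.of_forall fun n => (moment_le Y n).trans <|
      pow_le_pow_left₀ (sq_nonneg _) (pow_le_pow_left₀ (norm_nonneg _) hB 2) n)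
  refine ⟨fun hΓ => ?_, fun hlim => ?_⟩
  · exact tendsto_rpow_one_div_two_mul hcard (by positivity) hnonneg
      (fun b hb => pow_isBigO_moment hΓ hne hb.1.le hb.2) (hupp (norm_regRep_h_le Y))
  · by_contra hΓ
    have hlt := norm_regRep_h_lt hne hgen hΓ
    exact not_tendsto_rpow_one_div_two_mul (sq_nonneg _) hcard (by gcongr) hnonneg (hupp le_rfl)
      hlim

variable {q : ℕ}

lemma zeta_eq_reTrace_aeval_comp (hY : Y.card = q + 1) (n : ℕ) : zeta Y (n + 1) =
    reTrace (Polynomial.aeval (adjoint (h Y) * h Y)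
      ((Polynomial.dickson 1 ((q : ℝ) ^ 2) (n + 1)).comp
        (Polynomial.X - Polynomial.C (2 * (q : ℝ))))) + (q - 1) := by
  rw [zeta_eq n hY, Polynomial.aeval_comp, map_sub, Polynomial.aeval_X, Polynomial.aeval_C,
    Algebra.algebraMap_eq_smul_one, shiftedGram, ← Nat.cast_smul_eq_nsmul ℝ, Nat.cast_mul,
    Nat.cast_ofNat]

lemma exists_pos_mul_pow_le_zeta_add (hY : Y.card = q + 1) (hΓ : Amenable Γ) {b : ℝ}
    (hb : b ∈ Set.Ioo (q : ℝ) (q ^ 2)) :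
    ∃ d > 0, ∀ n, d * b ^ (n + 1) ≤ zeta Y (n + 1) + 2 * q ^ (n + 1) := by
  have hb₀ : 0 < b := q.cast_nonneg.trans_lt hb.1
  have hq₀ : (0 : ℝ) < q := q.cast_nonneg.lt_of_ne fun hq => by
    rw [← hq] at hb
    linarith [hb.2]
  have hq₁ : (1 : ℝ) ≤ q := by exact_mod_cast hq₀
  have hx₀ : b + q ^ 2 / b + 2 * q < (Y.card : ℝ) ^ 2 := by
    have hmono := strictMonoOn_add_sq_div hq₀ (Set.mem_Ici.2 hb.1.le)
      (Set.mem_Ici.2 (hb.1.trans hb.2).le) hb.2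
    simp only [div_self (pow_ne_zero 2 hq₀.ne')] at hmono
    rw [hY]
    push_cast
    linarith
  obtain ⟨d, hd, hlow⟩ := exists_pos_mul_le_reTrace_aeval hΓ (Finset.card_pos.1 (by omega)) hx₀
  refine ⟨d, hd, fun n => ?_⟩
  set p := (Polynomial.dickson 1 ((q : ℝ) ^ 2) (n + 1)).comp
    (Polynomial.X - Polynomial.C (2 * (q : ℝ))) with hp
  have heval (x : ℝ) :
      p.eval x = (Polynomial.dickson 1 ((q : ℝ) ^ 2) (n + 1)).eval (x - 2 * q) := by
    simp [hp]
  -- Adding the constant `2 q^n` makes the polynomial nonnegative on the spectrum.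
  have hmain := hlow (p + Polynomial.C (2 * (q : ℝ) ^ (n + 1))) (b ^ (n + 1)) (by positivity)
    (fun x hx => by
      rw [Polynomial.eval_add, Polynomial.eval_C, heval]
      linarith [neg_le_eval_dickson_one hq₀ (t := x - 2 * q) (by linarith [hx.1]) (n + 1)])
    fun x hx => by
      rw [Polynomial.eval_add, Polynomial.eval_C, heval]
      exact (pow_le_eval_dickson_one hq₀ hb.1 (by linarith [hx.1]) (n + 1)).trans
        (le_add_of_nonneg_right (by positivity))
  rw [map_add, map_add, Polynomial.aeval_C, Algebra.algebraMap_eq_smul_one, map_smul,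
    reTrace_one, smul_eq_mul, mul_one] at hmain
  rw [zeta_eq_reTrace_aeval_comp hY]
  linarith

lemma pow_isBigO_zeta (hY : Y.card = q + 1) (hΓ : Amenable Γ) {b : ℝ}
    (hb : b ∈ Set.Ioo (q : ℝ) (q ^ 2)) : (b ^ · : ℕ → ℝ) =O[atTop] zeta Y := by
  have hb₀ : 0 < b := q.cast_nonneg.trans_lt hb.1
  obtain ⟨d, hd, hzeta⟩ := exists_pos_mul_pow_le_zeta_add hY hΓ hb
  have hsum : (b ^ · : ℕ → ℝ) =O[atTop] fun n => zeta Y n + 2 * (q : ℝ) ^ n := by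
    refine .of_bound d⁻¹ (eventually_atTop.2 ⟨1, fun n hn => ?_⟩)
    obtain ⟨n, rfl⟩ := Nat.exists_eq_add_of_le' hn
    rw [Real.norm_of_nonneg (by positivity), le_inv_mul_iff₀ hd]
    exact (hzeta n).trans (le_abs_self _)
  have hsmall : (fun n => 2 * (q : ℝ) ^ n) =o[atTop] fun n => zeta Y n + 2 * (q : ℝ) ^ n :=
    ((isLittleO_pow_pow_of_lt_left q.cast_nonneg hb.1).const_mul_left 2).trans_isBigO hsum
  simpa only [add_sub_cancel_right] using hsum.trans hsmall.right_isBigO_sub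

lemma exists_lt_add_sq_div {q N : ℝ} (hq : 1 < q) (hN : N < (q + 1) ^ 2) :
    ∃ b ∈ Set.Ioo q (q ^ 2), N < b + q ^ 2 / b + 2 * q := by
  have hq₀ : q ^ 2 ≠ 0 := by positivity
  have hcont : ContinuousAt (fun b : ℝ => b + q ^ 2 / b + 2 * q) (q ^ 2) := by
    fun_prop (disch := assumption)
  have hval : N < q ^ 2 + q ^ 2 / q ^ 2 + 2 * q := by
    rw [div_self hq₀]
    linarith
  have hev := (hcont.eventually_const_lt hval).filter_mono
    (nhdsWithin_le_nhds (s := Set.Iio (q ^ 2)))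
  obtain ⟨b, hNb, hb⟩ := (hev.and (Ioo_mem_nhdsLT (by nlinarith : q < q ^ 2))).exists
  exact ⟨b, hb, hNb⟩

variable (hY : Y.card = q + 1)
  (hgen : Subgroup.closure ((Y : Set Γ)⁻¹ * (Y : Set Γ)) = ⊤)

include hY hgen in
lemma exists_zeta_isBigO_pow (hq : 2 ≤ q) (hΓ : ¬ Amenable Γ) :
    ∃ b ∈ Set.Ioo (q : ℝ) (q ^ 2), zeta Y =O[atTop] (b ^ · : ℕ → ℝ) := by
  have hq₂ : (2 : ℝ) ≤ q := by exact_mod_cast hq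
  have hnorm : ‖regRep (h Y)‖ ^ 2 < ((q : ℝ) + 1) ^ 2 := by
    have hlt := norm_regRep_h_lt (Finset.card_pos.1 (by omega)) hgen hΓ
    rw [hY, Nat.cast_add_one] at hlt
    gcongr
  obtain ⟨b, hb, hNb⟩ := exists_lt_add_sq_div (by linarith) hnorm
  have hb₁ : 1 ≤ b := by linarith [hb.1]
  refine ⟨b, hb, .of_bound (2 + (q - 1)) (eventually_atTop.2 ⟨1, fun n hn => ?_⟩)⟩
  obtain ⟨n, rfl⟩ := Nat.exists_eq_add_of_le' hn
  have htrace := reTrace_aeval_le (a := h Y) (C := 2 * b ^ (n + 1))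
    (p := (Polynomial.dickson 1 ((q : ℝ) ^ 2) (n + 1)).comp
      (Polynomial.X - Polynomial.C (2 * (q : ℝ)))) fun x hx => by
    rw [Polynomial.eval_comp, Polynomial.eval_sub, Polynomial.eval_X, Polynomial.eval_C]
    exact eval_dickson_one_le (by linarith) hb.1.le (by linarith [hx.1]) (by linarith [hx.2]) _
  rw [Real.norm_of_nonneg (zeta_nonneg Y _), Real.norm_of_nonneg (by positivity), add_mul]
  calc zeta Y (n + 1) ≤ 2 * b ^ (n + 1) + (q - 1) * 1 := by
        rw [zeta_eq_reTrace_aeval_comp hY, mul_one]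
        gcongr
    _ ≤ 2 * b ^ (n + 1) + (q - 1) * b ^ (n + 1) := by
        gcongr
        · linarith
        · exact one_le_pow₀ hb₁

include hY in
lemma norm2_hSeq_sq_isBigO_pow_of_zeta {b : ℝ} (hb : q < b)
    (hzeta : zeta Y =O[atTop] (b ^ · : ℕ → ℝ)) :
    (fun n => norm2 (hSeq Y n) ^ 2) =O[atTop] (b ^ · : ℕ → ℝ) := by
  have heta : eta Y =O[atTop] (b ^ · : ℕ → ℝ) := by
    refine isBigO_pow_of_linear_rec q.cast_nonneg hb ((isBigO_comp_add_one hzeta).sub hzeta)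
      (eventually_atTop.2 ⟨1, fun n hn => ?_⟩)
    obtain ⟨n, rfl⟩ := Nat.exists_eq_add_of_le' hn
    exact eta_succ n hY
  refine isBigO_pow_of_linear_rec q.cast_nonneg hb ((isBigO_comp_add_one heta).sub heta)
    (eventually_atTop.2 ⟨1, fun n hn => ?_⟩)
  obtain ⟨n, rfl⟩ := Nat.exists_eq_add_of_le' hn
  exact norm2_hSeq_sq_succ hY n

include hY in
lemma norm2_hSeq_sq_isBigO_pow (hq : 1 ≤ q) :
    (fun n => norm2 (hSeq Y n) ^ 2) =O[atTop] (((q : ℝ) ^ 2) ^ · : ℕ → ℝ) := by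
  refine .of_bound (((q : ℝ) + 1) ^ 2) (eventually_atTop.2 ⟨1, fun n hn => ?_⟩)
  obtain ⟨n, rfl⟩ := Nat.exists_eq_add_of_le' hn
  have hq₁ : (1 : ℝ) ≤ q := by exact_mod_cast hq
  rw [Real.norm_of_nonneg (sq_nonneg _), Real.norm_of_nonneg (by positivity), pow_right_comm,
    ← mul_pow]
  refine (norm2_hSeq_sq_le hY n).trans ?_
  gcongr
  exact n.le_succ

include hY hgen in
lemma amenable_iff_tendsto_rpow_one_div (hq : 2 ≤ q) {x : ℕ → ℝ}
    (hzeta : zeta Y ≤ᶠ[atTop] x) (hnorm : x ≤ᶠ[atTop] fun n => norm2 (hSeq Y n) ^ 2) :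
    Amenable Γ ↔ Tendsto (fun n : ℕ => x n ^ (1 / (2 * (n : ℝ)))) atTop (𝓝 (q : ℝ)) := by
  have hq₂ : (2 : ℝ) ≤ q := by exact_mod_cast hq
  have hq₀ : (0 : ℝ) < q := by linarith
  have hzeta₀ : ∀ᶠ n in atTop, 0 ≤ zeta Y n := .of_forall (zeta_nonneg Y)
  have hx₀ : ∀ᶠ n in atTop, 0 ≤ x n := hzeta₀.mp (hzeta.mono fun n hn h0 => h0.trans hn)
  have hxnorm := isBigO_of_eventually_le hx₀ hnorm
  refine ⟨fun hΓ => ?_, fun hlim => ?_⟩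
  · exact tendsto_rpow_one_div_two_mul hq₀ (by nlinarith : (q : ℝ) < q ^ 2) hx₀
      (fun b hb => (pow_isBigO_zeta hY hΓ hb).trans (isBigO_of_eventually_le hzeta₀ hzeta))
      (hxnorm.trans (norm2_hSeq_sq_isBigO_pow hY (by omega)))
  · by_contra hΓ
    obtain ⟨b, hb, hzetab⟩ := exists_zeta_isBigO_pow hY hgen hq hΓ
    exact not_tendsto_rpow_one_div_two_mul (hq₀.trans hb.1).le hq₀ hb.2 hx₀
      (hxnorm.trans (norm2_hSeq_sq_isBigO_pow_of_zeta hY hb.1 hzetab)) hlim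

end Cogrowth

lemma norm2_rpow_one_div {Γ : Type*} [Group Γ] (a : MonoidAlgebra ℂ Γ) (n : ℕ) :
    norm2 a ^ (1 / (n : ℝ)) = (norm2 a ^ 2) ^ (1 / (2 * (n : ℝ))) := by
  have hnorm : 0 ≤ norm2 a := Real.sqrt_nonneg _
  rw [← Real.rpow_natCast (norm2 a) 2, ← Real.rpow_mul hnorm, Nat.cast_ofNat, mul_one_div,
    ← div_div, div_self two_ne_zero]

end GroupCogrowth

end

theorem corollary7p9 {Γ : Type*} [Group Γ] (q : ℕ) (hq : 2 ≤ q) (Y : Finset Γ)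
    (hY : Y.card = q + 1)
    (hgen : Subgroup.closure ((Y : Set Γ)⁻¹ * (Y : Set Γ)) = ⊤) :
    List.TFAE [
      GroupCogrowth.Amenable Γ,
      Tendsto (fun n : ℕ => GroupCogrowth.norm2 (GroupCogrowth.hSeq Y n) ^ (1 / (n : ℝ)))
        atTop (𝓝 (q : ℝ)),
      Tendsto (fun n : ℕ => GroupCogrowth.xi Y q n ^ (1 / (2 * (n : ℝ)))) atTop (𝓝 (q : ℝ)),
      Tendsto (fun n : ℕ => GroupCogrowth.eta Y n ^ (1 / (2 * (n : ℝ)))) atTop (𝓝 (q : ℝ)),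
      Tendsto (fun n : ℕ => GroupCogrowth.zeta Y n ^ (1 / (2 * (n : ℝ)))) atTop (𝓝 (q : ℝ))] ∧
    (GroupCogrowth.Amenable Γ ↔
      Tendsto (fun n : ℕ => GroupCogrowth.moment Y n ^ (1 / (2 * (n : ℝ)))) atTop
        (𝓝 ((q : ℝ) + 1))) := by
  have hζη : GroupCogrowth.zeta Y ≤ᶠ[atTop] GroupCogrowth.eta Y :=
    .of_forall (GroupCogrowth.zeta_le_eta Y)
  have hηξ : GroupCogrowth.eta Y ≤ᶠ[atTop] GroupCogrowth.xi Y q :=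
    eventually_atTop.2 ⟨1, fun n hn => by
      obtain ⟨n, rfl⟩ := Nat.exists_eq_add_of_le' hn
      exact GroupCogrowth.eta_le_xi hY n (by omega)⟩
  have hξh : GroupCogrowth.xi Y q ≤ᶠ[atTop] fun n =>
      GroupCogrowth.norm2 (GroupCogrowth.hSeq Y n) ^ 2 :=
    .of_forall GroupCogrowth.xi_le_norm2_hSeq_sq
  have hamenable {x : ℕ → ℝ} := GroupCogrowth.amenable_iff_tendsto_rpow_one_div (x := x) hY hgen hq
  simp only [GroupCogrowth.norm2_rpow_one_div]
  constructor
  · tfae_have 1 ↔ 2 := hamenable (hζη.trans (hηξ.trans hξh)) EventuallyLE.rfl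
    tfae_have 1 ↔ 3 := hamenable (hζη.trans hηξ) hξh
    tfae_have 1 ↔ 4 := hamenable hζη (hηξ.trans hξh)
    tfae_have 1 ↔ 5 := hamenable EventuallyLE.rfl (hζη.trans (hηξ.trans hξh))
    tfae_finish
  · have hkesten := GroupCogrowth.amenable_iff_tendsto_moment (Finset.card_pos.1 (by omega)) hgen
    rwa [hY, Nat.cast_add_one] at hkesten
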